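/- Let $G=(V,E)$ be a tree (a connected acyclic graph, finite or countably infinite). For $q\in[0,1]$ and an integer $M\ge 1$, let $S_1,\dots,S_M\subseteq V$ be independent random sets such that every vertex belongs to each $S_m$ independently with probability $q$ ($M$ independent site-percolation instances of $G$), and let $G^{(M)}$ be the merged multilayer graph on $V$ in which an edge $\{u,v\}\in E$ is active if and only if $u,v\in S_m$ for at least one $m$. A spanning cluster is an infinite connected component. Let $$q_c(M)=\sup\{q\in[0,1]:\ G^{(M)}\text{ almost surely has no spanning cluster}\},$$ and let $p_c=\sup\{p\in[0,1]:\ \text{i.i.d. bond percolation on } G \text{ with bond probability } p \text{ almost surely has no spanning cluster}\}$ be the bond-percolation threshold of $G$. Then: (i) If $p_c<1$, then $$q_c(M)\sim \frac{c}{\sqrt M}\quad (M\to\infty),\qquad c=\sqrt{-\ln(1-p_c)}.$$ (If $p_c=0$, then $c=0$, and $\sim$ means that $q_c(M)=0$ for all large $M$.) (ii) Let $a\ge 0$ and let $q=q(M)\in[0,1]$ satisfy $q(M)=aM^{-1/2}(1+o(1))$ as $M\to\infty$. For every finite set $F\subseteq E$ of edges and every $x\in\{0,1\}^F$, the probability that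 every edge $e\in F$ of $G^{(M)}$ with site-occupation probability $q(M)$ is active if $x_e=1$ and inactive if $x_e=0$ converges, as $M\to\infty$, to $$\prod_{e\in F}\bigl(x_e(1-e^{-a^2})+(1-x_e)e^{-a^2}\bigr);$$ that is, the finite-dimensional distributions of the link states converge to those of i.i.d. Bernoulli$(1-e^{-a^2})$ variables. -/

import Mathlib

open MeasureTheory ProbabilityTheory Filter Topology Asymptotics unitInterval

noncomputable section

namespace MultilayerPercolation

variable {V : Type*}

/-- The subgraph of `G` left by a site configuration: `S` is the set of occupied sites, and a bond
of `G` is active when both of its endpoints are occupied. -/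
def siteGraph (G : SimpleGraph V) (S : Set V) : SimpleGraph V where
  Adj u v := G.Adj u v ∧ u ∈ S ∧ v ∈ S
  symm := ⟨fun _ _ h => ⟨h.1.symm, h.2.2, h.2.1⟩⟩
  loopless := ⟨fun _ h => G.irrefl h.1⟩

/-- The subgraph of `G` left by a bond configuration: `B` is the set of active bonds. -/
def bondGraph (G : SimpleGraph V) (B : Set (Sym2 V)) : SimpleGraph V where
  Adj u v := G.Adj u v ∧ s(u, v) ∈ B
  symm := ⟨fun _ _ h => ⟨h.1.symm, Sym2.eq_swap ▸ h.2⟩⟩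
  loopless := ⟨fun _ h => G.irrefl h.1⟩

/-- The multilayer graph `G^(M)`: the union of the `M` layers, where `ω m` is the set of sites that
are occupied in layer `m`. -/
def mergedGraph (G : SimpleGraph V) {M : ℕ} (ω : Fin M → Set V) : SimpleGraph V :=
  ⨆ m, siteGraph G (ω m)

/-- A graph has a spanning cluster when one of its connected components is infinite. -/
def HasInfiniteCluster (H : SimpleGraph V) : Prop :=
  ∃ C : H.ConnectedComponent, C.supp.Infinite

/-- The law of i.i.d. bond percolation on `G` with bond probability `p`. -/
def bondMeasure (G : SimpleGraph V) (p : I) : Measure (Set (Sym2 V)) :=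
  setBernoulli G.edgeSet p

/-- The law of `M` independent site configurations, in each of which every site is occupied
independently with probability `q`. -/
def layersMeasure (V : Type*) (M : ℕ) (q : I) : Measure (Fin M → Set V) :=
  Measure.pi fun _ => setBernoulli (Set.univ : Set V) q

/-- The bond-percolation threshold `p_c` of `G`: the supremum of the bond probabilities at which
there is almost surely no infinite cluster. -/
def bondThreshold (G : SimpleGraph V) : ℝ :=
  sSup {r : ℝ | ∃ p : I, (p : ℝ) = r ∧
    bondMeasure G p {B | HasInfiniteCluster (bondGraph G B)} = 0}

/-- The multilayer threshold `q_c(M)` of `G`: the supremum of the site-occupation probabilities at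
which the `M`-layer graph has almost surely no infinite cluster. -/
def multilayerThreshold (G : SimpleGraph V) (M : ℕ) : ℝ :=
  sSup {r : ℝ | ∃ q : I, (q : ℝ) = r ∧
    layersMeasure V M q {ω | HasInfiniteCluster (mergedGraph G ω)} = 0}

/-- The probability that, in the `M`-layer graph with site-occupation probability `q`, the links in
`F` are in the states prescribed by `x` (`true` for active, `false` for inactive). -/
def linkStateProb (G : SimpleGraph V) (M : ℕ) (q : I) (F : Finset (Sym2 V)) (x : Sym2 V → Bool) :
    ℝ :=
  (layersMeasure V M q).real {ω | ∀ e ∈ F, e ∈ (mergedGraph G ω).edgeSet ↔ x e = true}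

end MultilayerPercolation

end

/-! Root the tree and label each vertex with the set of layers that occupy it. Labels are
independent and identically distributed, and an edge is active iff the labels of its endpoints meet.
Given a label of size `k` at a vertex, the edge to a child is active with probability `1 - (1 - q) ^
k`. For `q ≈ a / √M` label sizes concentrate near `a√M`, so this probability is close to `1 - exp
(-a ^ 2)`. Exploration down the tree thus resembles bond percolation at that parameter, and equating
it with `p_c` gives `a = c`.

On a locally finite tree, an infinite cluster means downward paths of every length from some vertex
(`Rooting.hasInfiniteCluster_iff`). The probabilities of such paths, given the starting label, obey
a recursion over children (`measureReal_survival_succ`). They are compared with the analogous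
recursion for bonds: from above through a supersolution (`measureReal_survival_le`), from below by
keeping only good labels (`bondSurvival_le`). Chebyshev's inequality makes labels of atypical size
negligible, which gives `eventually_le_multilayerThreshold` and `eventually_multilayerThreshold_le`.
A vertex of infinite degree forces both thresholds to vanish (for `M > 0`).

For the link laws, a set `E` of edges is inactive iff every layer leaves it inactive. One layer
activates some edge of `E` with probability `|E| q ^ 2 + O(q ^ 3)`, and the `M`-th power of the
complement tends to `exp (-a ^ 2 |E|)`. Inclusion-exclusion handles the active edges. -/

noncomputable section

namespace MultilayerPercolation

variable {V : Type*}

/-! ### Rooted trees and infinite clusters as downward paths -/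

/-- A rooted orientation of a forest: every vertex of positive depth has a parent one level up, and
the edges are exactly the pairs formed by such a vertex and its parent. -/
structure Rooting (G : SimpleGraph V) where
  /-- The parent of a vertex; vertices of depth `0` are their own parents. -/
  parent : V → V
  /-- The distance to the root. -/
  depth : V → ℕ
  parent_eq_self : ∀ v, depth v = 0 → parent v = v
  depth_parent : ∀ v, depth v ≠ 0 → depth v = depth (parent v) + 1
  adj_iff : ∀ u v, G.Adj u v ↔ (depth v ≠ 0 ∧ parent v = u) ∨ (depth u ≠ 0 ∧ parent u = v)

/-- Extending geodesics to `u` and `u'` by one edge gives two paths from `r` to `v`. They coincide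
in a tree, hence so do their penultimate vertices. -/
lemma parent_unique_of_isTree {G : SimpleGraph V} (hG : G.IsTree) {r u u' v : V}
    (h : G.Adj u v) (h' : G.Adj u' v) (hd : G.dist r v = G.dist r u + 1)
    (hd' : G.dist r v = G.dist r u' + 1) : u = u' := by
  obtain ⟨p, hp, hpl⟩ := hG.connected.exists_path_of_dist r u
  obtain ⟨p', hp', hpl'⟩ := hG.connected.exists_path_of_dist r u'
  have h1 : (p.concat h).IsPath := SimpleGraph.Walk.isPath_of_length_eq_dist _ (by
    rw [SimpleGraph.Walk.length_concat]; omega)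
  have h2 : (p'.concat h').IsPath := SimpleGraph.Walk.isPath_of_length_eq_dist _ (by
    rw [SimpleGraph.Walk.length_concat]; omega)
  have := (hG.existsUnique_path r v).unique h1 h2
  have := congrArg SimpleGraph.Walk.penultimate this
  simpa using this

lemma exists_rooting {G : SimpleGraph V} (hG : G.IsTree) : Nonempty (Rooting G) := by
  classical
  obtain ⟨r⟩ := hG.connected.nonempty
  have hex : ∀ v, G.dist r v ≠ 0 → ∃ u, G.Adj u v ∧ G.dist r v = G.dist r u + 1 := by
    intro v hv
    obtain ⟨p, hp, hpl⟩ := hG.connected.exists_path_of_dist r v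
    have hnil : ¬ p.Nil := fun h => hv (by
      rw [← hpl]
      exact SimpleGraph.Walk.length_eq_zero_iff.2 (by simpa using h))
    have hadj := p.adj_penultimate hnil
    refine ⟨p.penultimate, hadj, ?_⟩
    have h1 : G.dist r p.penultimate ≤ p.dropLast.length := SimpleGraph.dist_le _
    have h2 : p.dropLast.length + 1 = p.length := by
      have := congrArg SimpleGraph.Walk.length (p.concat_dropLast hadj)
      rwa [SimpleGraph.Walk.length_concat] at this
    have h3 := hG.dist_eq_dist_add_one_of_adj r hadj
    omega
  choose! f hf hfd using hex
  refine ⟨⟨fun v => if G.dist r v = 0 then v else f v, G.dist r, ?_, ?_, ?_⟩⟩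
  · intro v hv; simp [hv]
  · intro v hv; simpa [hv] using hfd v hv
  · intro u v
    constructor
    · intro h
      rcases hG.dist_eq_dist_add_one_of_adj r h with h1 | h1
      · right
        have h0 : G.dist r u ≠ 0 := by omega
        refine ⟨h0, ?_⟩
        simp only [h0, if_false]
        exact parent_unique_of_isTree hG (hf u h0) h.symm (hfd u h0) h1
      · left
        have h0 : G.dist r v ≠ 0 := by omega
        refine ⟨h0, ?_⟩
        simp only [h0, if_false]
        exact parent_unique_of_isTree hG (hf v h0) h (hfd v h0) h1
    · rintro (⟨h0, h⟩ | ⟨h0, h⟩)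
      · simp only [h0, if_false] at h
        exact h ▸ hf v h0
      · simp only [h0, if_false] at h
        exact (h ▸ hf u h0).symm

namespace Rooting

variable {G : SimpleGraph V} (R : Rooting G)

/-- `w` is a child of `v`. -/
def IsChild (v w : V) : Prop := R.depth w ≠ 0 ∧ R.parent w = v

/-- The vertices of the subtree hanging from `v`. -/
def descendants (v : V) : Set V :=
  {u | ∃ k, R.depth u = R.depth v + k ∧ R.parent^[k] u = v}

/-- The vertices strictly below `v`. -/
def properDescendants (v : V) : Set V :=
  {u | ∃ k, R.depth u = R.depth v + (k + 1) ∧ R.parent^[k + 1] u = v}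

variable {R}

lemma IsChild.depth_eq {v w : V} (h : R.IsChild v w) : R.depth w = R.depth v + 1 := by
  rw [R.depth_parent w h.1, h.2]

lemma IsChild.adj {v w : V} (h : R.IsChild v w) : G.Adj v w := (R.adj_iff v w).2 (Or.inl h)

lemma adj_iff_isChild {v w : V} : G.Adj v w ↔ R.IsChild v w ∨ R.IsChild w v := R.adj_iff v w

lemma mem_descendants_self (v : V) : v ∈ R.descendants v := ⟨0, rfl, rfl⟩

lemma properDescendants_subset (v : V) : R.properDescendants v ⊆ R.descendants v :=
  fun _ ⟨k, h⟩ => ⟨k + 1, h⟩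

lemma notMem_properDescendants_self (v : V) : v ∉ R.properDescendants v := by
  rintro ⟨k, h, -⟩
  omega

lemma IsChild.descendants_subset {v w : V} (h : R.IsChild v w) :
    R.descendants w ⊆ R.properDescendants v := by
  rintro u ⟨k, hk, hu⟩
  refine ⟨k, by rw [hk, h.depth_eq]; ring, ?_⟩
  rw [Function.iterate_succ_apply', hu, h.2]

lemma disjoint_descendants {w w' : V} (hd : R.depth w = R.depth w') (hne : w ≠ w') :
    Disjoint (R.descendants w) (R.descendants w') := by
  rw [Set.disjoint_left]
  rintro u ⟨k, hk, hu⟩ ⟨k', hk', hu'⟩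
  obtain rfl : k = k' := by omega
  exact hne (hu.symm.trans hu')

variable (R)

/-- Lets bonds be carried by vertices as independent labels. A vertex of depth `0` carries a
diagonal pair, and two vertices cannot be parents of each other because depths would disagree. -/
lemma edge_injective : Function.Injective fun v => s(v, R.parent v) := by
  intro v w h
  by_contra hne
  simp only [Sym2.eq_iff] at h
  rcases h with ⟨h, -⟩ | ⟨h, h'⟩
  · exact hne h
  by_cases hv : R.depth v = 0
  · exact hne (by rw [← h', R.parent_eq_self v hv])
  by_cases hw : R.depth w = 0
  · exact hne (by rw [h, R.parent_eq_self w hw])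
  have h1 := R.depth_parent v hv
  have h2 := R.depth_parent w hw
  rw [h'] at h1
  rw [← h] at h2
  omega

/-- In the subgraph `H` there is a path of length `n` from `v` away from the root. -/
def HasDownPath (H : SimpleGraph V) : ℕ → V → Prop
  | 0, _ => True
  | n + 1, v => ∃ w, R.IsChild v w ∧ H.Adj v w ∧ HasDownPath H n w

/-- The `n`-th generation below `v` in the subgraph `H`. -/
def level (H : SimpleGraph V) (v : V) : ℕ → Set V
  | 0 => {v}
  | n + 1 => {u | ∃ w ∈ level H v n, R.IsChild w u ∧ H.Adj w u}

variable {R} {H : SimpleGraph V}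

lemma HasDownPath.exists_reachable {n : ℕ} {v : V} (h : R.HasDownPath H n v) :
    ∃ u, H.Reachable v u ∧ R.depth u = R.depth v + n := by
  induction n generalizing v with
  | zero => exact ⟨v, .refl v, rfl⟩
  | succ n ih =>
    obtain ⟨w, hw, hvw, hn⟩ := h
    obtain ⟨u, hu, hd⟩ := ih hn
    exact ⟨u, hvw.reachable.trans hu, by rw [hd, hw.depth_eq]; ring⟩

lemma HasDownPath.hasInfiniteCluster {v : V} (h : ∀ n, R.HasDownPath H n v) :
    HasInfiniteCluster H := by
  refine ⟨H.connectedComponentMk v, fun hfin => ?_⟩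
  obtain ⟨N, hN⟩ := (hfin.image R.depth).bddAbove
  obtain ⟨u, hu, hd⟩ := (h (N + 1)).exists_reachable
  have : R.depth u ≤ N := hN ⟨u, by simpa using hu.symm, rfl⟩
  omega

lemma HasDownPath.of_mem_level {n k : ℕ} {u v : V} (hu : u ∈ R.level H v n)
    (h : R.HasDownPath H k u) : R.HasDownPath H (n + k) v := by
  induction n generalizing u k with
  | zero =>
    obtain rfl : u = v := hu
    simpa using h
  | succ n ih =>
    obtain ⟨w, hw, hwu, hadj⟩ := hu
    have := ih hw (k := k + 1) ⟨u, hwu, hadj, h⟩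
    rwa [show n + 1 + k = n + (k + 1) by ring]

lemma finite_level (hle : H ≤ G) (hfin : ∀ v, (G.neighborSet v).Finite) (v : V) (n : ℕ) :
    (R.level H v n).Finite := by
  induction n with
  | zero => exact Set.finite_singleton v
  | succ n ih =>
    refine (ih.biUnion fun w _ => hfin w).subset ?_
    rintro u ⟨w, hw, -, hadj⟩
    exact Set.mem_biUnion hw (hle hadj)

lemma level_eq_empty_of_le {v : V} {n m : ℕ} (hnm : n ≤ m) (h : R.level H v n = ∅) :
    R.level H v m = ∅ := by
  induction m, hnm using Nat.le_induction with
  | base => exact h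
  | succ m _ ih =>
    ext u
    simp [level, ih]

/-- A walk from the topmost vertex `v` stays in the levels below `v`: a step away from the root
enters the next level, and a step towards it returns to the unique parent, already in the previous
level. -/
lemma exists_mem_level_of_reachable (hle : H ≤ G) {v u : V} (hvu : H.Reachable v u)
    (hmin : ∀ w, H.Reachable v w → R.depth v ≤ R.depth w) : ∃ n, u ∈ R.level H v n := by
  have key : ∀ {x y : V}, H.Walk x y → H.Reachable v x → (∃ n, x ∈ R.level H v n) →
      ∃ n, y ∈ R.level H v n := by
    intro x y p
    induction p with
    | nil => exact fun _ h => h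
    | @cons x z y hxz p ih =>
      rintro hvx ⟨n, hn⟩
      have hvz : H.Reachable v z := hvx.trans hxz.reachable
      refine ih hvz ?_
      rcases R.adj_iff_isChild.1 (hle hxz) with hc | hc
      · exact ⟨n + 1, x, hn, hc, hxz⟩
      · cases n with
        | zero =>
          obtain rfl : x = v := hn
          have h1 := hmin z hvz
          have h2 := hc.depth_eq
          omega
        | succ n =>
          obtain ⟨w, hw, hwx, -⟩ := hn
          obtain rfl : w = z := hwx.2.symm.trans hc.2
          exact ⟨n, hw⟩
  obtain ⟨p⟩ := hvu
  exact key p (.refl v) ⟨0, rfl⟩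

/-- Take `v` of minimal depth in an infinite cluster. Were some level below `v` empty, the cluster
would be a finite union of levels, each finite by local finiteness. -/
lemma hasInfiniteCluster_iff (hle : H ≤ G) (hfin : ∀ v, (G.neighborSet v).Finite) :
    HasInfiniteCluster H ↔ ∃ v, ∀ n, R.HasDownPath H n v := by
  refine ⟨?_, fun ⟨v, hv⟩ => HasDownPath.hasInfiniteCluster hv⟩
  rintro ⟨C, hC⟩
  obtain ⟨v, hv, hvd⟩ := Nat.sInf_mem (hC.nonempty.image R.depth)
  have hmin : ∀ w, H.Reachable v w → R.depth v ≤ R.depth w := fun w hw =>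
    hvd ▸ Nat.sInf_le ⟨w, (SimpleGraph.ConnectedComponent.sound hw.symm).trans hv, rfl⟩
  refine ⟨v, fun n => ?_⟩
  by_contra hn
  have hempty : R.level H v n = ∅ := by
    rw [Set.eq_empty_iff_forall_notMem]
    intro u hu
    exact hn (by simpa using HasDownPath.of_mem_level (k := 0) hu trivial)
  refine hC (((Set.finite_lt_nat n).biUnion fun m _ => finite_level (R := R) hle hfin v m).subset ?_)
  intro u hu
  have hvu : H.Reachable v u := SimpleGraph.ConnectedComponent.exact (hv.trans hu.symm)
  obtain ⟨m, hm⟩ := exists_mem_level_of_reachable hle hvu hmin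
  refine Set.mem_biUnion (x := m) ?_ hm
  by_contra hnm
  rw [level_eq_empty_of_le (not_lt.1 hnm) hempty] at hm
  exact hm

end Rooting

/-! ### Survival probabilities of independently labelled trees -/

section Labels

variable {Ω Λ : Type*}

/-- Given that `v` carries the label `a`, there is a path of length `n` from `v` away from the root
along which consecutive labels are related by `r`. -/
def survival (ch : V → Finset V) (A : V → Ω → Λ) (r : Λ → Λ → Prop) : ℕ → V → Λ → Set Ω
  | 0, _, _ => Set.univ
  | n + 1, v, a => {ω | ∃ w ∈ ch v, r a (A w ω) ∧ ω ∈ survival ch A r n w (A w ω)}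

lemma survival_succ_subset (ch : V → Finset V) (A : V → Ω → Λ) (r : Λ → Λ → Prop) (n : ℕ) (v : V)
    (a : Λ) : survival ch A r (n + 1) v a ⊆ survival ch A r n v a := by
  induction n generalizing v a with
  | zero => exact Set.subset_univ _
  | succ n ih =>
    rintro ω ⟨w, hw, hr, h⟩
    exact ⟨w, hw, hr, ih w _ h⟩

lemma antitone_survival (ch : V → Finset V) (A : V → Ω → Λ) (r : Λ → Λ → Prop) (v : V) (a : Λ) :
    Antitone fun n => survival ch A r n v a :=
  antitone_nat_of_succ_le fun n => survival_succ_subset ch A r n v a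

lemma transmission_eq_iUnion (ch : V → Finset V) (A : V → Ω → Λ) (r : Λ → Λ → Prop) (n : ℕ) (w : V)
    (a : Λ) : {ω | r a (A w ω) ∧ ω ∈ survival ch A r n w (A w ω)} =
      ⋃ b ∈ {b | r a b}, A w ⁻¹' {b} ∩ survival ch A r n w b := by
  ext ω
  simp

lemma hasDownPath_iff_mem_survival {G : SimpleGraph V} {R : Rooting G}
    {ch : V → Finset V} {A : V → Ω → Λ} {r : Λ → Λ → Prop}
    (hch : ∀ v w, w ∈ ch v ↔ R.IsChild v w) {H : SimpleGraph V} {ω : Ω}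
    (hH : ∀ v w, R.IsChild v w → (H.Adj v w ↔ r (A v ω) (A w ω))) (n : ℕ) (v : V) :
    R.HasDownPath H n v ↔ ω ∈ survival ch A r n v (A v ω) := by
  induction n generalizing v with
  | zero => simp [Rooting.HasDownPath, survival]
  | succ n ih =>
    simp only [Rooting.HasDownPath, survival, Set.mem_ofPred_eq, hch]
    exact exists_congr fun w => and_congr_right fun hw => by rw [hH v w hw, ih]

/-- The σ-algebra generated by the labels of the vertices in `S`. -/
@[reducible]
def labelSigma [MeasurableSpace Λ] (A : V → Ω → Λ) (S : Set V) : MeasurableSpace Ω :=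
  ⨆ v ∈ S, MeasurableSpace.comap (A v) inferInstance

lemma labelSigma_mono [MeasurableSpace Λ] {A : V → Ω → Λ} {S T : Set V} (h : S ⊆ T) :
    labelSigma A S ≤ labelSigma A T :=
  biSup_mono h

lemma measurableSet_preimage_label [MeasurableSpace Λ] {A : V → Ω → Λ} {S : Set V} {v : V}
    (hv : v ∈ S) {B : Set Λ}
    (hB : MeasurableSet B) : MeasurableSet[labelSigma A S] (A v ⁻¹' B) :=
  le_iSup₂ (f := fun v _ => MeasurableSpace.comap (A v) inferInstance) v hv _ ⟨B, hB, rfl⟩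

/-- The label of `v` enters only through the fixed parameter `a`, so proper descendants suffice.
This is what makes survival independent of the label at `v`. -/
lemma measurableSet_survival [Fintype Λ] [MeasurableSpace Λ] [MeasurableSingletonClass Λ]
    {G : SimpleGraph V} {R : Rooting G} {ch : V → Finset V} {A : V → Ω → Λ} {r : Λ → Λ → Prop}
    (hch : ∀ v w, w ∈ ch v ↔ R.IsChild v w) (n : ℕ) (v : V) (a : Λ) :
    MeasurableSet[labelSigma A (R.properDescendants v)] (survival ch A r n v a) := by
  induction n generalizing v a with
  | zero => exact @MeasurableSet.univ _ (labelSigma A (R.properDescendants v))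
  | succ n ih =>
    have heq : survival ch A r (n + 1) v a =
        ⋃ w ∈ ch v, {ω | r a (A w ω) ∧ ω ∈ survival ch A r n w (A w ω)} := by
      ext ω
      simp [survival, and_left_comm]
    rw [heq]
    refine @Finset.measurableSet_biUnion _ _ (labelSigma A (R.properDescendants v)) _ _ fun w hw => ?_
    have hsub := ((hch v w).1 hw).descendants_subset
    rw [transmission_eq_iUnion]
    refine @Set.Finite.measurableSet_biUnion _ _ (labelSigma A (R.properDescendants v)) _ _
      (Set.toFinite _) fun b _ => ?_
    exact (measurableSet_preimage_label (hsub (R.mem_descendants_self w))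
      (measurableSet_singleton b)).inter
      (labelSigma_mono ((R.properDescendants_subset w).trans hsub) _ (ih w b))

lemma measurableSet_transmission [Fintype Λ] [MeasurableSpace Λ] [MeasurableSingletonClass Λ]
    {G : SimpleGraph V} {R : Rooting G} {ch : V → Finset V} {A : V → Ω → Λ} {r : Λ → Λ → Prop}
    (hch : ∀ v w, w ∈ ch v ↔ R.IsChild v w) (n : ℕ) (w : V) (a : Λ) :
    MeasurableSet[labelSigma A (R.descendants w)]
      {ω | r a (A w ω) ∧ ω ∈ survival ch A r n w (A w ω)} := by
  rw [transmission_eq_iUnion]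
  refine @Set.Finite.measurableSet_biUnion _ _ (labelSigma A (R.descendants w)) _ _
    (Set.toFinite _) fun b _ => ?_
  exact (measurableSet_preimage_label (R.mem_descendants_self w) (measurableSet_singleton b)).inter
    (labelSigma_mono (R.properDescendants_subset w) _ (measurableSet_survival hch n w b))

variable [MeasurableSpace Ω] [MeasurableSpace Λ]

/-- The labels of disjoint sets of vertices are independent. -/
def IndepLabels (A : V → Ω → Λ) (μ : Measure Ω) : Prop :=
  ∀ S T : Set V, Disjoint S T → Indep (labelSigma A S) (labelSigma A T) μ

variable {A : V → Ω → Λ} {μ : Measure Ω}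

lemma labelSigma_le (hA : ∀ v, Measurable (A v)) (S : Set V) :
    labelSigma A S ≤ ‹MeasurableSpace Ω› :=
  iSup₂_le fun v _ => (hA v).comap_le

lemma IndepLabels.measureReal_inter (hind : IndepLabels A μ) {S T : Set V} (hST : Disjoint S T)
    {E F : Set Ω} (hE : MeasurableSet[labelSigma A S] E) (hF : MeasurableSet[labelSigma A T] F) :
    μ.real (E ∩ F) = μ.real E * μ.real F := by
  simp only [Measure.real, ((Indep_iff _ _ μ).1 (hind S T hST)) E F hE hF, ENNReal.toReal_mul]

lemma IndepLabels.measureReal_biInter [IsProbabilityMeasure μ] (hind : IndepLabels A μ)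
    {ι : Type*} (s : Finset ι) {D : ι → Set V} (hD : (s : Set ι).PairwiseDisjoint D)
    {T : ι → Set Ω} (hT : ∀ i ∈ s, MeasurableSet[labelSigma A (D i)] (T i)) :
    μ.real (⋂ i ∈ s, T i) = ∏ i ∈ s, μ.real (T i) := by
  classical
  induction s using Finset.induction_on with
  | empty => simp
  | insert i s hi ih =>
    rw [Finset.prod_insert hi, Finset.set_biInter_insert,
      ← ih (hD.subset (by simp)) fun j hj => hT j (Finset.mem_insert_of_mem hj)]
    refine hind.measureReal_inter (S := D i) (T := ⋃ j ∈ s, D j) ?_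
      (hT i (Finset.mem_insert_self i s)) ?_
    · rw [Set.disjoint_iUnion₂_right]
      intro j hj
      exact hD (by simp) (by simp [hj]) (by rintro rfl; exact hi hj)
    · exact Finset.measurableSet_biInter (m := labelSigma A (⋃ j ∈ s, D j)) s fun j hj =>
        labelSigma_mono (Set.subset_biUnion_of_mem (u := D) (show j ∈ (s : Set ι) from hj)) _
          (hT j (Finset.mem_insert_of_mem hj))

lemma measureReal_label_mem [IsFiniteMeasure μ] [Fintype Λ] [MeasurableSingletonClass Λ] {X : Ω → Λ}
    (hX : Measurable X) (p : Λ → Prop) [DecidablePred p] :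
    μ.real {ω | p (X ω)} = ∑ b, if p b then μ.real (X ⁻¹' {b}) else 0 := by
  rw [← Finset.sum_filter, sum_measureReal_preimage_singleton _
    fun b _ => hX (measurableSet_singleton b)]
  congr 1
  ext ω
  simp

variable [Fintype Λ] [MeasurableSingletonClass Λ] {G : SimpleGraph V} {R : Rooting G}
  {ch : V → Finset V} {r : Λ → Λ → Prop}

lemma measureReal_label_inter_survival (hind : IndepLabels A μ)
    (hch : ∀ v w, w ∈ ch v ↔ R.IsChild v w) (n : ℕ) (v : V) (a b : Λ) :
    μ.real (A v ⁻¹' {b} ∩ survival ch A r n v a) =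
      μ.real (A v ⁻¹' {b}) * μ.real (survival ch A r n v a) :=
  hind.measureReal_inter (S := {v}) (T := R.properDescendants v)
    (Set.disjoint_singleton_left.2 (R.notMem_properDescendants_self v))
    (measurableSet_preimage_label (Set.mem_singleton v) (measurableSet_singleton b)) (measurableSet_survival hch n v a)

open Classical in
lemma measureReal_transmission [IsProbabilityMeasure μ] (hA : ∀ v, Measurable (A v))
    (hind : IndepLabels A μ) (hch : ∀ v w, w ∈ ch v ↔ R.IsChild v w) (n : ℕ) (w : V) (a : Λ) :
    μ.real {ω | r a (A w ω) ∧ ω ∈ survival ch A r n w (A w ω)} =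
      ∑ b, if r a b then μ.real (A w ⁻¹' {b}) * μ.real (survival ch A r n w b) else 0 := by
  rw [← Finset.sum_filter]
  have : {ω | r a (A w ω) ∧ ω ∈ survival ch A r n w (A w ω)} =
      ⋃ b ∈ Finset.univ.filter (r a ·), A w ⁻¹' {b} ∩ survival ch A r n w b := by
    ext ω
    simp
  rw [this, measureReal_biUnion_finset]
  · exact Finset.sum_congr rfl fun b _ => measureReal_label_inter_survival hind hch n w b b
  · intro b _ b' _ hbb
    refine Set.disjoint_left.2 ?_
    rintro ω ⟨h, -⟩ ⟨h', -⟩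
    exact hbb (h.symm.trans h')
  · exact fun b _ => (hA w (measurableSet_singleton b)).inter
      (labelSigma_le hA _ _ (measurableSet_survival hch n w b))

open Classical in
/-- The recursion for the survival probabilities on a tree. -/
lemma measureReal_survival_succ [IsProbabilityMeasure μ] (hA : ∀ v, Measurable (A v))
    (hind : IndepLabels A μ) (hch : ∀ v w, w ∈ ch v ↔ R.IsChild v w) (n : ℕ) (v : V) (a : Λ) :
    μ.real (survival ch A r (n + 1) v a) = 1 - ∏ w ∈ ch v,
      (1 - ∑ b, if r a b then μ.real (A w ⁻¹' {b}) * μ.real (survival ch A r n w b) else 0) := by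
  have hmeas := fun w => measurableSet_transmission (A := A) (r := r) hch n w a
  have heq : survival ch A r (n + 1) v a =
      (⋂ w ∈ ch v, {ω | r a (A w ω) ∧ ω ∈ survival ch A r n w (A w ω)}ᶜ)ᶜ := by
    ext ω
    simp only [survival, Set.mem_ofPred_eq, Set.mem_compl_iff, Set.mem_iInter, not_forall, not_not,
      exists_prop]
  -- Subtrees of distinct children are disjoint, so the failures along the children are independent
  -- and their probabilities multiply.
  have hdisj : (ch v : Set V).PairwiseDisjoint R.descendants := by
    intro w hw w' hw' hne
    refine R.disjoint_descendants ?_ hne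
    rw [((hch v w).1 hw).depth_eq, ((hch v w').1 hw').depth_eq]
  rw [heq, probReal_compl_eq_one_sub, hind.measureReal_biInter (ch v) hdisj fun w _ => (hmeas w).compl]
  · congr 1
    refine Finset.prod_congr rfl fun w _ => ?_
    rw [probReal_compl_eq_one_sub (labelSigma_le hA _ _ (hmeas w)),
      measureReal_transmission hA hind hch]
  · exact Finset.measurableSet_biInter _ fun w _ => (labelSigma_le hA _ _ (hmeas w)).compl

/-- Almost surely no infinite cluster, in terms of the survival probabilities. -/
lemma measure_hasInfiniteCluster_eq_zero_iff [Countable V] [IsProbabilityMeasure μ]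
    (hA : ∀ v, Measurable (A v)) (hind : IndepLabels A μ)
    (hfin : ∀ v, (G.neighborSet v).Finite) (hch : ∀ v w, w ∈ ch v ↔ R.IsChild v w)
    {H : Ω → SimpleGraph V} (hle : ∀ ω, H ω ≤ G)
    (hH : ∀ ω v w, R.IsChild v w → ((H ω).Adj v w ↔ r (A v ω) (A w ω))) :
    μ {ω | HasInfiniteCluster (H ω)} = 0 ↔ ∀ v a, μ.real (A v ⁻¹' {a}) ≠ 0 →
      Tendsto (fun n => μ.real (survival ch A r n v a)) atTop (𝓝 0) := by
  have heq : {ω | HasInfiniteCluster (H ω)} =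
      ⋃ v, ⋃ a, A v ⁻¹' {a} ∩ ⋂ n, survival ch A r n v a := by
    ext ω
    simp only [Set.mem_ofPred_eq, R.hasInfiniteCluster_iff (hle ω) hfin,
      hasDownPath_iff_mem_survival hch (hH ω)]
    simp
  -- Factor by independence at each finite `n`, then let `n` grow using continuity from above.
  have hlim : ∀ v a, Tendsto (fun n => μ.real (A v ⁻¹' {a}) * μ.real (survival ch A r n v a)) atTop
      (𝓝 (μ.real (A v ⁻¹' {a} ∩ ⋂ n, survival ch A r n v a))) := by
    intro v a
    simp only [← measureReal_label_inter_survival hind hch, Set.inter_iInter]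
    refine (ENNReal.tendsto_toReal (measure_ne_top _ _)).comp
      (tendsto_measure_iInter_atTop (fun n => ?_) ?_ ⟨0, measure_ne_top _ _⟩)
    · exact ((hA v (measurableSet_singleton a)).inter
        (labelSigma_le hA _ _ (measurableSet_survival hch n v a))).nullMeasurableSet
    · exact fun m n hmn => Set.inter_subset_inter_right _ (antitone_survival ch A r v a hmn)
  rw [heq]
  simp only [measure_iUnion_null_iff]
  refine forall₂_congr fun v a => ?_
  rw [← measureReal_eq_zero_iff]
  constructor
  · intro h h0
    have := (hlim v a).const_mul (μ.real (A v ⁻¹' {a}))⁻¹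
    simpa [h, inv_mul_cancel_left₀ h0] using this
  · intro h
    by_cases h0 : μ.real (A v ⁻¹' {a}) = 0
    · exact measureReal_mono_null Set.inter_subset_left h0
    · have := (h h0).const_mul (μ.real (A v ⁻¹' {a}))
      rw [mul_zero] at this
      exact tendsto_nhds_unique (hlim v a) this

end Labels

/-! ### Comparison of survival recursions -/

section Comparison

lemma prod_one_sub_mem_Icc {ι : Type*} (s : Finset ι) {x : ι → ℝ} (hx : ∀ i ∈ s, x i ∈ Set.Icc 0 1) :
    ∏ i ∈ s, (1 - x i) ∈ Set.Icc (0 : ℝ) 1 :=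
  ⟨Finset.prod_nonneg fun i hi => sub_nonneg.2 (hx i hi).2,
    Finset.prod_le_one (fun i hi => sub_nonneg.2 (hx i hi).2) fun i hi => by linarith [(hx i hi).1]⟩

/-- A union-type probability grows at most linearly when its inputs are scaled by `h ≥ 1`. In the
induction, if `h * y i ≥ 1` or `h * (1 - Q) ≥ 1` the right side is at least `1`. Otherwise expand `1
- (1 - y i) * Q = y i + (1 - y i) * (1 - Q)` and use `1 - h * y i ≤ 1 - y i`. -/
lemma one_sub_prod_one_sub_le_mul {ι : Type*} (s : Finset ι) {x y : ι → ℝ} {h : ℝ} (hh : 1 ≤ h)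
    (hx : ∀ i ∈ s, x i ∈ Set.Icc 0 1) (hy : ∀ i ∈ s, y i ∈ Set.Icc 0 1)
    (hxy : ∀ i ∈ s, x i ≤ h * y i) :
    1 - ∏ i ∈ s, (1 - x i) ≤ h * (1 - ∏ i ∈ s, (1 - y i)) := by
  classical
  induction s using Finset.induction_on with
  | empty => simp
  | insert i s hi ih =>
    have ih := ih (fun j hj => hx j (Finset.mem_insert_of_mem hj))
      (fun j hj => hy j (Finset.mem_insert_of_mem hj))
      (fun j hj => hxy j (Finset.mem_insert_of_mem hj))
    obtain ⟨hP0, hP1⟩ := prod_one_sub_mem_Icc s fun j hj => hx j (Finset.mem_insert_of_mem hj)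
    obtain ⟨hQ0, hQ1⟩ := prod_one_sub_mem_Icc s fun j hj => hy j (Finset.mem_insert_of_mem hj)
    obtain ⟨hx0, hx1⟩ := hx i (Finset.mem_insert_self i s)
    obtain ⟨hy0, hy1⟩ := hy i (Finset.mem_insert_self i s)
    have hxyi := hxy i (Finset.mem_insert_self i s)
    rw [Finset.prod_insert hi, Finset.prod_insert hi]
    set P := ∏ j ∈ s, (1 - x j)
    set Q := ∏ j ∈ s, (1 - y j)
    have hPpos : 0 ≤ (1 - x i) * P := mul_nonneg (by linarith) hP0
    rcases le_total 1 (h * y i) with h1 | h1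
    · have : 0 ≤ h * ((1 - y i) * (1 - Q)) :=
        mul_nonneg (by linarith) (mul_nonneg (by linarith) (by linarith))
      nlinarith
    rcases le_total 1 (h * (1 - Q)) with h2 | h2
    · have : 0 ≤ h * (y i * Q) := mul_nonneg (by linarith) (mul_nonneg hy0 hQ0)
      nlinarith
    have h3 : x i * P ≤ h * y i * P := mul_le_mul_of_nonneg_right hxyi hP0
    have h4 : 0 ≤ (1 - h * y i) * (h * (1 - Q) - (1 - P)) :=
      mul_nonneg (by linarith) (by linarith)
    have h5 : 0 ≤ (h - 1) * (h * (y i * (1 - Q))) :=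
      mul_nonneg (by linarith) (mul_nonneg (by linarith) (mul_nonneg hy0 (by linarith)))
    nlinarith

/-- The probability that i.i.d. bond percolation on the tree contains a path of length `n` from a
given vertex away from the root. -/
def bondSurvival (ch : V → Finset V) (p : ℝ) : ℕ → V → ℝ
  | 0, _ => 1
  | n + 1, v => 1 - ∏ w ∈ ch v, (1 - p * bondSurvival ch p n w)

lemma bondSurvival_mem_Icc (ch : V → Finset V) {p : ℝ} (hp : p ∈ Set.Icc 0 1) (n : ℕ) (v : V) :
    bondSurvival ch p n v ∈ Set.Icc (0 : ℝ) 1 := by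
  induction n generalizing v with
  | zero => simp [bondSurvival]
  | succ n ih =>
    obtain ⟨h0, h1⟩ := prod_one_sub_mem_Icc (ch v) fun w _ => unitInterval.mul_mem hp (ih w)
    exact ⟨sub_nonneg.2 h1, sub_le_self _ h0⟩

variable {Ω Λ : Type*} [MeasurableSpace Ω] [MeasurableSpace Λ] [Fintype Λ]
  [MeasurableSingletonClass Λ] {A : V → Ω → Λ} {μ : Measure Ω} [IsProbabilityMeasure μ]
  {G : SimpleGraph V} {R : Rooting G} {ch : V → Finset V} {r : Λ → Λ → Prop} {p : ℝ}

open Classical in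
/-- A supersolution `h` of the transfer operator bounds the survival probabilities. -/
lemma measureReal_survival_le (hA : ∀ v, Measurable (A v)) (hind : IndepLabels A μ)
    (hch : ∀ v w, w ∈ ch v ↔ R.IsChild v w) (hp : p ∈ Set.Icc 0 1) {h : Λ → ℝ} (hh : ∀ a, 1 ≤ h a)
    (hsup : ∀ w a, ∑ b, (if r a b then μ.real (A w ⁻¹' {b}) * h b else 0) ≤ p * h a)
    (n : ℕ) (v : V) (a : Λ) :
    μ.real (survival ch A r n v a) ≤ h a * bondSurvival ch p n v := by
  induction n generalizing v a with
  | zero => simpa [survival, bondSurvival] using hh a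
  | succ n ih =>
    rw [measureReal_survival_succ hA hind hch, bondSurvival]
    -- The scaling inequality is applied with the transmission probabilities as `x`, the bond terms
    -- `p * bondSurvival` as `y`, and factor `h a`.
    refine one_sub_prod_one_sub_le_mul (ch v) (hh a) (fun w _ => ?_)
      (fun w _ => unitInterval.mul_mem hp (bondSurvival_mem_Icc ch hp n w)) fun w _ => ?_
    · rw [← measureReal_transmission hA hind hch]
      exact ⟨measureReal_nonneg, measureReal_le_one⟩
    · calc _ ≤ ∑ b, (if r a b then μ.real (A w ⁻¹' {b}) * h b else 0) * bondSurvival ch p n w := by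
            refine Finset.sum_le_sum fun b _ => ?_
            split_ifs
            · rw [mul_assoc]
              exact mul_le_mul_of_nonneg_left (ih w b) measureReal_nonneg
            · simp
        _ ≤ p * h a * bondSurvival ch p n w := by
            rw [← Finset.sum_mul]
            exact mul_le_mul_of_nonneg_right (hsup w a) (bondSurvival_mem_Icc ch hp n w).1
        _ = h a * (p * bondSurvival ch p n w) := by ring

open Classical in
/-- If from every good label a good related label is reached with probability at least `p`, then
the survival probabilities dominate those of bond percolation. -/
lemma bondSurvival_le (hA : ∀ v, Measurable (A v)) (hind : IndepLabels A μ)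
    (hch : ∀ v w, w ∈ ch v ↔ R.IsChild v w) (hp : p ∈ Set.Icc 0 1) {good : Λ → Prop}
    (hgood : ∀ w a, good a → p ≤ μ.real {ω | r a (A w ω) ∧ good (A w ω)})
    (n : ℕ) (v : V) {a : Λ} (ha : good a) :
    bondSurvival ch p n v ≤ μ.real (survival ch A r n v a) := by
  induction n generalizing v a with
  | zero => simp [survival, bondSurvival]
  | succ n ih =>
    rw [measureReal_survival_succ hA hind hch, bondSurvival]
    refine sub_le_sub_left (Finset.prod_le_prod (fun w _ => ?_) fun w _ => sub_le_sub_left ?_ 1) 1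
    · rw [← measureReal_transmission hA hind hch]
      exact sub_nonneg.2 measureReal_le_one
    · calc _ ≤ μ.real {ω | r a (A w ω) ∧ good (A w ω)} * bondSurvival ch p n w :=
            mul_le_mul_of_nonneg_right (hgood w a ha) (bondSurvival_mem_Icc ch hp n w).1
        _ = ∑ b, (if r a b ∧ good b then μ.real (A w ⁻¹' {b}) else 0) * bondSurvival ch p n w := by
            rw [measureReal_label_mem (hA w) fun b => r a b ∧ good b, Finset.sum_mul]
        _ ≤ _ := by
            refine Finset.sum_le_sum fun b _ => ?_
            by_cases hr : r a b
            · by_cases hb : good b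
              · simpa [hr, hb] using mul_le_mul_of_nonneg_left (ih w hb) measureReal_nonneg
              · simp only [hr, hb, and_false, if_false, zero_mul, if_true]
                positivity
            · simp [hr]

end Comparison

/-! ### Bernoulli configurations and layer labels -/

section Measures

lemma iIndepFun_map_iff {ι Ω Ω' : Type*} [MeasurableSpace Ω] [MeasurableSpace Ω'] {μ : Measure Ω}
    [IsProbabilityMeasure μ] {β : ι → Type*} [∀ i, MeasurableSpace (β i)] {f : Ω → Ω'}
    (hf : Measurable f) {X : ∀ i, Ω' → β i} (hX : ∀ i, Measurable (X i)) :
    iIndepFun X (μ.map f) ↔ iIndepFun (fun i ω => X i (f ω)) μ := by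
  have := Measure.isProbabilityMeasure_map (μ := μ) hf.aemeasurable
  rw [iIndepFun_iff_map_fun_eq_infinitePi_map hX,
    iIndepFun_iff_map_fun_eq_infinitePi_map (X := fun i ω => X i (f ω)) fun i => (hX i).comp hf,
    Measure.map_map (measurable_pi_lambda _ hX) hf]
  simp only [Measure.map_map (hX _) hf]
  rfl

lemma iIndepFun_mem_setBernoulli {ι : Type*} (u : Set ι) (p : I) :
    iIndepFun (fun i (B : Set ι) => i ∈ B) (setBernoulli u p) := by
  rw [setBernoulli_eq_map, iIndepFun_map_iff (by fun_prop) (by fun_prop)]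
  exact iIndepFun_infinitePi (X := fun _ x => x) (by fun_prop)

lemma setBernoulli_real_mem {ι : Type*} {u : Set ι} (p : I) {i : ι} (hi : i ∈ u) :
    (setBernoulli u p).real {B | i ∈ B} = p := by
  rw [setBernoulli_eq_map, map_measureReal_apply (by fun_prop) (measurableSet_mem i)]
  have : (fun f : ι → Prop => {a | f a}) ⁻¹' {B | i ∈ B} = (fun f : ι → Prop => f i) ⁻¹' {True} := by
    ext f
    simp
  rw [this, ← map_measureReal_apply (by fun_prop) (measurableSet_singleton _),
    Measure.infinitePi_map_eval]
  simp [hi, Measure.real]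

variable (V) in
lemma measurePreserving_layer (M : ℕ) (q : I) (m : Fin M) :
    MeasurePreserving (fun ω : Fin M → Set V => ω m) (layersMeasure V M q)
      (setBernoulli Set.univ q) :=
  measurePreserving_eval (fun _ : Fin M => setBernoulli (Set.univ : Set V) q) m

instance (M : ℕ) (q : I) : IsProbabilityMeasure (layersMeasure V M q) := by
  unfold layersMeasure
  infer_instance

instance (G : SimpleGraph V) (p : I) : IsProbabilityMeasure (bondMeasure G p) := by
  unfold bondMeasure
  infer_instance

lemma layersMeasure_real_mem (M : ℕ) (q : I) (m : Fin M) (v : V) :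
    (layersMeasure V M q).real {ω | v ∈ ω m} = q := by
  rw [← setBernoulli_real_mem q (Set.mem_univ v), ← (measurePreserving_layer V M q m).map_eq,
    map_measureReal_apply (measurable_pi_apply m) (measurableSet_mem v)]
  rfl

lemma iIndepFun_mem_layersMeasure (M : ℕ) (q : I) :
    iIndepFun (fun (x : Fin M × V) (ω : Fin M → Set V) => x.2 ∈ ω x.1) (layersMeasure V M q) := by
  refine iIndepFun_uncurry' (X := fun m v (ω : Fin M → Set V) => v ∈ ω m) (by fun_prop) ?_ fun m => ?_
  · exact iIndepFun_pi (X := fun _ (S : Set V) v => v ∈ S) fun _ => by fun_prop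
  · refine (iIndepFun_map_iff (f := fun ω : Fin M → Set V => ω m) (X := fun v (S : Set V) => v ∈ S)
      (measurable_pi_apply m) (by fun_prop)).1 ?_
    rw [(measurePreserving_layer V M q m).map_eq]
    exact iIndepFun_mem_setBernoulli _ q

lemma measurableSet_mem_layer {M : ℕ} (m : Fin M) (v : V) :
    MeasurableSet {ω : Fin M → Set V | v ∈ ω m} :=
  measurableSet_preimage (t := {S : Set V | v ∈ S}) (measurable_pi_apply m) (measurableSet_mem v)

/-- The set of layers in which a vertex is occupied. -/
def layersAt {M : ℕ} (v : V) (ω : Fin M → Set V) : Set (Fin M) := {m | v ∈ ω m}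

lemma measurable_layersAt {M : ℕ} (v : V) : Measurable (layersAt (M := M) v) :=
  measurable_set_iff.2 fun m => (measurable_set_mem v).comp (measurable_pi_apply m)

/-- Labels over disjoint vertex sets are functions of disjoint families of the independent bits
indexed by `Fin M × V`. -/
lemma indepLabels_layersAt (M : ℕ) (q : I) :
    IndepLabels (layersAt (M := M)) (layersMeasure V M q) := by
  intro S T hST
  have h := indep_iSup_of_disjoint (S := {x : Fin M × V | x.2 ∈ S}) (T := {x : Fin M × V | x.2 ∈ T})
    (fun x => Measurable.comap_le (by fun_prop)) (iIndepFun_mem_layersMeasure (V := V) M q).iIndep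
    (Set.disjoint_left.2 fun x hx hx' => Set.disjoint_left.1 hST hx hx')
  have hle : ∀ S : Set V, labelSigma (layersAt (M := M)) S ≤
      ⨆ x ∈ {x : Fin M × V | x.2 ∈ S},
        MeasurableSpace.comap (fun ω : Fin M → Set V => x.2 ∈ ω x.1) inferInstance := by
    refine fun S => iSup₂_le fun v hv => measurable_iff_comap_le.1 ?_
    refine @measurable_set_iff _ _ (_) _ |>.2 fun m => ?_
    refine measurable_iff_comap_le.2 (le_iSup₂_of_le (m, v) hv le_rfl)
  exact indep_of_indep_of_le_left (indep_of_indep_of_le_right h (hle T)) (hle S)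

lemma IndepLabels.of_iIndepFun {Ω Λ : Type*} [MeasurableSpace Ω] [MeasurableSpace Λ]
    {A : V → Ω → Λ} {μ : Measure Ω} (hA : ∀ v, Measurable (A v)) (h : iIndepFun A μ) :
    IndepLabels A μ := fun _ _ hST =>
  indep_iSup_of_disjoint (fun v => (hA v).comap_le) h.iIndep hST

lemma iIndepFun_layersAt_mem {M : ℕ} (q : I) (v : V) :
    iIndepFun (fun m (ω : Fin M → Set V) => v ∈ ω m) (layersMeasure V M q) :=
  (iIndepFun_mem_layersMeasure M q).precomp (g := fun m => (m, v)) fun _ _ h => (Prod.ext_iff.1 h).1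

lemma layersMeasure_real_disjoint (M : ℕ) (q : I) (v : V) (a : Set (Fin M)) :
    (layersMeasure V M q).real {ω | Disjoint a (layersAt v ω)} = (1 - q : ℝ) ^ a.ncard := by
  classical
  have hset : {ω : Fin M → Set V | Disjoint a (layersAt v ω)} =
      ⋂ m ∈ a.toFinset, (fun ω : Fin M → Set V => v ∈ ω m) ⁻¹' {False} := by
    ext ω
    simp [Set.disjoint_left, layersAt]
  rw [hset, Measure.real, (iIndepFun_layersAt_mem q v).meas_biInter fun m _ =>
    ⟨{False}, measurableSet_singleton _, rfl⟩, ENNReal.toReal_prod]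
  have : ∀ m : Fin M, (layersMeasure V M q ((fun ω => v ∈ ω m) ⁻¹' {False})).toReal = 1 - q := by
    intro m
    rw [← layersMeasure_real_mem M q m v, ← probReal_compl_eq_one_sub (measurableSet_mem_layer m v), Measure.real]
    congr 2
    ext ω
    simp
  simp only [this, Finset.prod_const]
  rw [Set.ncard_eq_toFinset_card']

/-- Chebyshev's inequality: the label size is a sum of `M` independent indicators, each of variance
at most `q`. -/
lemma layersMeasure_real_deviation (M : ℕ) (q : I) (v : V) {t : ℝ} (ht : 0 < t) :
    (layersMeasure V M q).real {ω | t ≤ |((layersAt v ω).ncard : ℝ) - M * q|} ≤ M * q / t ^ 2 := by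
  classical
  let X : Fin M → (Fin M → Set V) → ℝ := fun m => Set.indicator {ω | v ∈ ω m} 1
  have hmeas := fun m : Fin M => measurableSet_mem_layer m v
  have hX : ∀ m, MemLp (X m) 2 (layersMeasure V M q) := fun m =>
    (memLp_const (1 : ℝ)).indicator (hmeas m)
  have hmean : ∀ m, ∫ ω, X m ω ∂(layersMeasure V M q) = q := fun m => by
    rw [integral_indicator_one (hmeas m), layersMeasure_real_mem]
  have hvar : ∀ m, variance (X m) (layersMeasure V M q) ≤ q := fun m => by
    refine (variance_le_expectation_sq (hX m).1).trans (le_of_eq ?_)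
    rw [← hmean m]
    congr 1
    ext ω
    by_cases h : v ∈ ω m <;> simp [X, h]
  have hind : ∀ i j, i ≠ j → IndepFun (X i) (X j) (layersMeasure V M q) := by
    intro i j hij
    have h := (iIndepFun_layersAt_mem (M := M) q v).indepFun hij
    have := h.comp (φ := fun P : Prop => if P then (1 : ℝ) else 0)
      (ψ := fun P : Prop => if P then (1 : ℝ) else 0) Measurable.of_discrete Measurable.of_discrete
    convert! this using 1
  have hsum : ∀ ω, (∑ m, X m) ω = ((layersAt v ω).ncard : ℝ) := by
    intro ω
    rw [Finset.sum_apply, Set.ncard_eq_toFinset_card']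
    simp only [X, Set.indicator_apply, Set.mem_ofPred_eq, Pi.one_apply, Finset.sum_boole]
    congr 2
    ext m
    simp only [Finset.mem_filter, Finset.mem_univ, true_and, Set.mem_toFinset]
    rfl
  have hEsum : ∫ ω, (∑ m, X m) ω ∂(layersMeasure V M q) = M * q := by
    simp only [Finset.sum_apply]
    rw [integral_finsetSum _ fun m _ => (hX m).integrable one_le_two]
    simp [hmean]
  have hV : variance (∑ m, X m) (layersMeasure V M q) ≤ M * q := by
    rw [IndepFun.variance_sum (fun m _ => hX m) fun i _ j _ hij => hind i j hij]
    refine (Finset.sum_le_sum fun m _ => hvar m).trans ?_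
    simp
  have h := meas_ge_le_variance_div_sq (memLp_finsetSum' Finset.univ fun m _ => hX m) ht
  rw [hEsum] at h
  simp only [hsum] at h
  calc _ ≤ variance (∑ m, X m) (layersMeasure V M q) / t ^ 2 :=
        ENNReal.toReal_le_of_le_ofReal (div_nonneg (variance_nonneg _ _) (sq_nonneg t)) h
    _ ≤ _ := by gcongr

end Measures

/-! ### Transfer of null events between multilayer and bond percolation -/

section Criteria

variable {G : SimpleGraph V} {R : Rooting G} {ch : V → Finset V}

lemma mergedGraph_le {M : ℕ} (ω : Fin M → Set V) : mergedGraph G ω ≤ G :=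
  iSup_le fun _ _ _ h => h.1

lemma mergedGraph_adj_iff {M : ℕ} (ω : Fin M → Set V) (v w : V) :
    (mergedGraph G ω).Adj v w ↔ G.Adj v w ∧ ¬ Disjoint (layersAt v ω) (layersAt w ω) := by
  simp [mergedGraph, siteGraph, layersAt, Set.not_disjoint_iff]

lemma Rooting.exists_children (R : Rooting G) (hfin : ∀ v, (G.neighborSet v).Finite) :
    ∃ ch : V → Finset V, ∀ v w, w ∈ ch v ↔ R.IsChild v w :=
  ⟨fun v => ((hfin v).subset fun _ hw => hw.adj : {w | R.IsChild v w}.Finite).toFinset,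
    fun v w => by simp⟩

/-- Each vertex is labelled by the state of the edge to its parent, and the relation reads only the
child's label. Survival then does not depend on the starting label and follows the bond recursion.
-/
lemma measure_bond_eq_zero_iff [Countable V] (hfin : ∀ v, (G.neighborSet v).Finite)
    (hch : ∀ v w, w ∈ ch v ↔ R.IsChild v w) (p : I) :
    bondMeasure G p {B | HasInfiniteCluster (bondGraph G B)} = 0 ↔
      ∀ v, Tendsto (fun n => bondSurvival ch p n v) atTop (𝓝 0) := by
  classical
  let A : V → Set (Sym2 V) → Prop := fun v B => s(v, R.parent v) ∈ B
  have hA : ∀ v, Measurable (A v) := fun v => measurable_set_mem _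
  have hind : IndepLabels A (bondMeasure G p) :=
    .of_iIndepFun hA ((iIndepFun_mem_setBernoulli G.edgeSet p).precomp R.edge_injective)
  have hp : ∀ v w, R.IsChild v w → (bondMeasure G p).real {B | A w B} = p := by
    intro v w hvw
    have hmem : s(w, R.parent w) ∈ G.edgeSet := by
      rw [hvw.2]
      exact hvw.adj.symm
    exact setBernoulli_real_mem p hmem
  have hsurv : ∀ n v a, (bondMeasure G p).real (survival ch A (fun _ b => b) n v a) =
      bondSurvival ch p n v := by
    intro n
    induction n with
    | zero => simp [survival, bondSurvival]
    | succ n ih =>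
      intro v a
      rw [measureReal_survival_succ hA hind hch, bondSurvival]
      congr 1
      refine Finset.prod_congr rfl fun w hw => ?_
      simp [hp v w ((hch v w).1 hw), ih]
  rw [measure_hasInfiniteCluster_eq_zero_iff (r := fun _ b => b) hA hind hfin hch
    (H := bondGraph G) (fun _ _ _ h => h.1) fun B v w hvw => by
      simp only [bondGraph, hvw.adj, true_and, A, hvw.2]
      rw [Sym2.eq_swap]]
  simp only [hsurv]
  refine ⟨fun h v => ?_, fun h v _ _ => h v⟩
  by_contra hv
  -- The label probabilities at `v` sum to `1`, so they cannot all vanish.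
  have hzero : ∀ a, (bondMeasure G p).real (A v ⁻¹' {a}) = 0 := fun a => by
    by_contra ha
    exact hv (h v a ha)
  have := measureReal_label_mem (μ := bondMeasure G p) (hA v) fun _ => True
  simp [hzero] at this

open Classical in
/-- If bond percolation at `p` has no infinite cluster and there is a supersolution with factor `p`,
then the multilayer graph has no infinite cluster. -/
lemma measure_merged_eq_zero [Countable V] (hfin : ∀ v, (G.neighborSet v).Finite)
    (R : Rooting G) {M : ℕ} {p q : I}
    (hnull : bondMeasure G p {B | HasInfiniteCluster (bondGraph G B)} = 0)
    {h : Set (Fin M) → ℝ} (hh : ∀ a, 1 ≤ h a)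
    (hsup : ∀ (w : V) a, ∑ b, (if ¬ Disjoint a b then
      (layersMeasure V M q).real (layersAt w ⁻¹' {b}) * h b else 0) ≤ p * h a) :
    layersMeasure V M q {ω | HasInfiniteCluster (mergedGraph G ω)} = 0 := by
  obtain ⟨ch, hch⟩ := R.exists_children hfin
  rw [measure_bond_eq_zero_iff hfin hch] at hnull
  rw [measure_hasInfiniteCluster_eq_zero_iff measurable_layersAt (indepLabels_layersAt M q) hfin hch
    (r := fun a b => ¬ Disjoint a b) mergedGraph_le
    fun ω v w hvw => by simp [mergedGraph_adj_iff, hvw.adj]]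
  intro v a _
  have := (hnull v).const_mul (h a)
  rw [mul_zero] at this
  exact squeeze_zero (fun n => measureReal_nonneg) (fun n => measureReal_survival_le
    measurable_layersAt (indepLabels_layersAt M q) hch p.2 hh
    (fun w a => by convert hsup w a) n v a) this

/-- If the multilayer graph has no infinite cluster and good labels lead to good labels with
probability at least `p`, then bond percolation at `p` has no infinite cluster. -/
lemma measure_bond_eq_zero [Countable V] (hfin : ∀ v, (G.neighborSet v).Finite)
    (R : Rooting G) {M : ℕ} {p q : I}
    (hnull : layersMeasure V M q {ω | HasInfiniteCluster (mergedGraph G ω)} = 0)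
    {good : Set (Fin M) → Prop}
    (hpos : ∀ v : V, 0 < (layersMeasure V M q).real {ω | good (layersAt v ω)})
    (hgood : ∀ (w : V) a, good a → (p : ℝ) ≤ (layersMeasure V M q).real
      {ω | ¬ Disjoint a (layersAt w ω) ∧ good (layersAt w ω)}) :
    bondMeasure G p {B | HasInfiniteCluster (bondGraph G B)} = 0 := by
  classical
  obtain ⟨ch, hch⟩ := R.exists_children hfin
  rw [measure_hasInfiniteCluster_eq_zero_iff measurable_layersAt (indepLabels_layersAt M q) hfin hch
    (r := fun a b => ¬ Disjoint a b) mergedGraph_le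
    fun ω v w hvw => by simp [mergedGraph_adj_iff, hvw.adj]] at hnull
  rw [measure_bond_eq_zero_iff hfin hch]
  intro v
  obtain ⟨a, ha, ha0⟩ : ∃ a, good a ∧ (layersMeasure V M q).real (layersAt v ⁻¹' {a}) ≠ 0 := by
    by_contra! hcon
    have := hpos v
    rw [measureReal_label_mem (measurable_layersAt v)] at this
    refine this.ne' (Finset.sum_eq_zero fun a _ => ?_)
    split_ifs with h
    exacts [hcon a h, rfl]
  exact squeeze_zero (fun n => (bondSurvival_mem_Icc ch p.2 n v).1) (fun n => bondSurvival_le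
    measurable_layersAt (indepLabels_layersAt M q) hch p.2 hgood n v ha) (hnull v a ha0)

end Criteria

/-! ### Vertices of infinite degree -/

section InfiniteDegree

lemma HasInfiniteCluster.of_infinite_adj {H : SimpleGraph V} {v : V} (h : {w | H.Adj v w}.Infinite) :
    HasInfiniteCluster H :=
  ⟨H.connectedComponentMk v, h.mono fun _ hw =>
    SimpleGraph.ConnectedComponent.sound (SimpleGraph.Adj.reachable hw).symm⟩

/-- The second Borel-Cantelli lemma. -/
lemma ae_infinite_of_iIndepFun {Ω : Type*} [MeasurableSpace Ω] {μ : Measure Ω}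
    {X : ℕ → Ω → Prop} (hX : ∀ n, Measurable (X n)) (hind : iIndepFun X μ) {p : ℝ} (hp : 0 < p)
    (hXp : ∀ n, μ.real {ω | X n ω} = p) : ∀ᵐ ω ∂μ, {n | X n ω}.Infinite := by
  have := hind.isProbabilityMeasure
  have hmeas : ∀ n, MeasurableSet {ω | X n ω} := fun n => measurableSet_setOfPred.2 (hX n)
  have hset : iIndepSet (fun n => {ω | X n ω}) μ := by
    rw [iIndepSet_iff_meas_biInter hmeas]
    intro s
    refine hind.meas_biInter fun n _ => ⟨{True}, measurableSet_singleton _, ?_⟩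
    ext ω
    simp
  have hsum : ∑' n, μ {ω | X n ω} = ⊤ := by
    have : ∀ n, μ {ω | X n ω} = ENNReal.ofReal p := fun n => by
      rw [← hXp n, ofReal_measureReal]
    simp only [this]
    exact ENNReal.tsum_const_eq_top_of_ne_zero (by simpa using hp)
  have h1 := measure_limsup_eq_one hmeas hset hsum
  have h2 : MeasurableSet (limsup (fun n => {ω | X n ω}) atTop) := MeasurableSet.measurableSet_limsup hmeas
  filter_upwards [(mem_ae_iff_prob_eq_one h2).2 h1] with ω hω
  rw [mem_limsup_iff_frequently_mem] at hω
  exact Nat.frequently_atTop_iff_infinite.1 hω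

variable {G : SimpleGraph V}

lemma measure_bond_ne_zero_of_infinite {v : V} (hv : (G.neighborSet v).Infinite) {p : I}
    (hp : 0 < (p : ℝ)) : bondMeasure G p {B | HasInfiniteCluster (bondGraph G B)} ≠ 0 := by
  let f := hv.natEmbedding
  have hinj : Function.Injective fun n => s(v, (f n : V)) := fun m n h =>
    f.injective (Subtype.ext (Sym2.congr_right.1 h))
  have h := ae_infinite_of_iIndepFun (X := fun n (B : Set (Sym2 V)) => s(v, (f n : V)) ∈ B)
    (fun n => measurable_set_mem _)
    ((iIndepFun_mem_setBernoulli G.edgeSet p).precomp hinj) hp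
    fun n => setBernoulli_real_mem p (f n).2
  intro h0
  have : ∀ᵐ B ∂(bondMeasure G p), HasInfiniteCluster (bondGraph G B) := by
    filter_upwards [h] with B hB
    refine HasInfiniteCluster.of_infinite_adj (v := v)
      ((hB.image (f := fun n => (f n : V)) (Subtype.val_injective.comp f.injective).injOn).mono ?_)
    rintro _ ⟨n, hn, rfl⟩
    exact ⟨(f n).2, hn⟩
  have hcompl : ∀ᵐ B ∂(bondMeasure G p), ¬ HasInfiniteCluster (bondGraph G B) := by
    rw [ae_iff]
    simpa using h0
  obtain ⟨B, hB, hB'⟩ := (this.and hcompl).exists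
  exact hB' hB

/-- One layer suffices: almost surely it occupies infinitely many neighbours of `v`, and with
probability `q > 0` it occupies `v` as well. -/
lemma measure_merged_ne_zero_of_infinite {v : V} (hv : (G.neighborSet v).Infinite) {M : ℕ}
    (hM : 0 < M) {q : I} (hq : 0 < (q : ℝ)) :
    layersMeasure V M q {ω | HasInfiniteCluster (mergedGraph G ω)} ≠ 0 := by
  let f := hv.natEmbedding
  have hinj : Function.Injective fun n => ((⟨0, hM⟩ : Fin M), (f n : V)) := fun m n h =>
    f.injective (Subtype.ext (Prod.ext_iff.1 h).2)
  have h := ae_infinite_of_iIndepFun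
    (X := fun n (ω : Fin M → Set V) => (f n : V) ∈ ω ⟨0, hM⟩) (fun n => by fun_prop)
    ((iIndepFun_mem_layersMeasure (V := V) M q).precomp hinj) hq
    fun n => layersMeasure_real_mem M q _ _
  intro h0
  have hcompl : ∀ᵐ ω ∂(layersMeasure V M q), v ∉ ω ⟨0, hM⟩ := by
    have h1 : ∀ᵐ ω ∂(layersMeasure V M q), ¬ HasInfiniteCluster (mergedGraph G ω) := by
      rw [ae_iff]
      simpa using h0
    filter_upwards [h, h1] with ω hω hω1 hvω
    refine hω1 (HasInfiniteCluster.of_infinite_adj (v := v)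
      ((hω.image (f := fun n => (f n : V)) (Subtype.val_injective.comp f.injective).injOn).mono ?_))
    rintro _ ⟨n, hn, rfl⟩
    exact (mergedGraph_adj_iff ω _ _).2 ⟨(f n).2, Set.not_disjoint_iff.2 ⟨_, hvω, hn⟩⟩
  have h2 := layersMeasure_real_mem M q ⟨0, hM⟩ v
  rw [ae_iff] at hcompl
  simp only [not_not] at hcompl
  rw [Measure.real, hcompl] at h2
  exact hq.ne h2

end InfiniteDegree

/-! ### Asymptotics of the multilayer threshold -/

section Thresholds

variable {G : SimpleGraph V}

lemma le_bondThreshold {p : I}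
    (h : bondMeasure G p {B | HasInfiniteCluster (bondGraph G B)} = 0) : p ≤ bondThreshold G :=
  le_csSup ⟨1, by rintro _ ⟨p, rfl, -⟩; exact p.2.2⟩ ⟨p, rfl, h⟩

lemma le_multilayerThreshold {M : ℕ} {q : I}
    (h : layersMeasure V M q {ω | HasInfiniteCluster (mergedGraph G ω)} = 0) :
    q ≤ multilayerThreshold G M :=
  le_csSup ⟨1, by rintro _ ⟨p, rfl, -⟩; exact p.2.2⟩ ⟨q, rfl, h⟩

lemma bondThreshold_nonneg : 0 ≤ bondThreshold G :=
  Real.sSup_nonneg (by rintro _ ⟨p, rfl, -⟩; exact p.2.1)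

lemma multilayerThreshold_nonneg (M : ℕ) : 0 ≤ multilayerThreshold G M :=
  Real.sSup_nonneg (by rintro _ ⟨p, rfl, -⟩; exact p.2.1)

lemma exists_null_of_lt_bondThreshold {x : ℝ} (hx : 0 ≤ x) (h : x < bondThreshold G) :
    ∃ p : I, x < p ∧ bondMeasure G p {B | HasInfiniteCluster (bondGraph G B)} = 0 := by
  have hne : {r : ℝ | ∃ p : I, (p : ℝ) = r ∧
      bondMeasure G p {B | HasInfiniteCluster (bondGraph G B)} = 0}.Nonempty := by
    by_contra hne
    rw [Set.not_nonempty_iff_eq_empty] at hne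
    -- The supremum of the empty set is `0` by convention, which contradicts `0 ≤ x < bondThreshold
    -- G`.
    rw [bondThreshold, hne, Real.sSup_empty] at h
    linarith
  obtain ⟨_, ⟨p, rfl, hp⟩, hxp⟩ := exists_lt_of_lt_csSup hne h
  exact ⟨p, hxp, hp⟩

lemma bondThreshold_eq_zero_of_infinite {v : V} (hv : (G.neighborSet v).Infinite) :
    bondThreshold G = 0 := by
  refine le_antisymm (Real.sSup_le ?_ le_rfl) bondThreshold_nonneg
  rintro _ ⟨p, rfl, hp⟩
  by_contra! hpos
  exact measure_bond_ne_zero_of_infinite hv hpos hp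

lemma multilayerThreshold_eq_zero_of_infinite {v : V} (hv : (G.neighborSet v).Infinite) {M : ℕ}
    (hM : 0 < M) : multilayerThreshold G M = 0 := by
  refine le_antisymm (Real.sSup_le ?_ le_rfl) (multilayerThreshold_nonneg M)
  rintro _ ⟨q, rfl, hq⟩
  by_contra! hpos
  exact measure_merged_ne_zero_of_infinite hv hM hpos hq

lemma layersMeasure_real_not_disjoint (M : ℕ) (q : I) (v : V) (a : Set (Fin M)) :
    (layersMeasure V M q).real {ω | ¬ Disjoint a (layersAt v ω)} = 1 - (1 - q : ℝ) ^ a.ncard := by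
  rw [← layersMeasure_real_disjoint M q v a, ← probReal_compl_eq_one_sub]
  · rfl
  · exact measurable_layersAt v (Set.toFinite {b | Disjoint a b}).measurableSet

variable [Countable V]

/-- Call a label good if it contains layer `0`. Good labels meet, and a child is good with
probability `q`, so a single layer already dominates bond percolation at `q`. This settles the case
`p_c = 0`. -/
lemma multilayerThreshold_le_bondThreshold (R : Rooting G) (hfin : ∀ v, (G.neighborSet v).Finite)
    {M : ℕ} (hM : 0 < M) : multilayerThreshold G M ≤ bondThreshold G := by
  refine Real.sSup_le ?_ bondThreshold_nonneg
  rintro _ ⟨q, rfl, hq⟩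
  by_cases hq0 : (q : ℝ) = 0
  · rw [hq0]
    exact bondThreshold_nonneg
  have hpos : 0 < (q : ℝ) := lt_of_le_of_ne q.2.1 (Ne.symm hq0)
  refine le_bondThreshold (measure_bond_eq_zero hfin R hq (good := fun a => ⟨0, hM⟩ ∈ a)
    (fun v => ?_) fun w a ha => ?_)
  · exact hpos.trans_eq (layersMeasure_real_mem M q ⟨0, hM⟩ v).symm
  · rw [← layersMeasure_real_mem M q ⟨0, hM⟩ w]
    exact measureReal_mono fun ω hω => ⟨Set.not_disjoint_iff.2 ⟨_, ha, hω⟩, hω⟩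

/-- A criterion for the absence of infinite clusters in the multilayer graph: labels of size more
than `k` are rare, and the other labels transmit with probability less than `p`. -/
lemma measure_merged_eq_zero_of_tail (R : Rooting G) (hfin : ∀ v, (G.neighborSet v).Finite)
    {M k : ℕ} {p q : I} (hp : 0 < (p : ℝ))
    (hnull : bondMeasure G p {B | HasInfiniteCluster (bondGraph G B)} = 0) {T : ℝ}
    (hT : ∀ w : V, (layersMeasure V M q).real {ω | k < (layersAt w ω).ncard} ≤ T)
    (hT1 : 2 / p * T ≤ 1) (hk : 1 - (1 - q : ℝ) ^ k + 2 / p * T ≤ p) :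
    layersMeasure V M q {ω | HasInfiniteCluster (mergedGraph G ω)} = 0 := by
  classical
  have hL : 1 ≤ 2 / (p : ℝ) := by rw [le_div_iff₀ hp]; linarith [p.2.2]
  have hq0 : (0 : ℝ) ≤ 1 - q := sub_nonneg.2 q.2.2
  have hq1 : (1 : ℝ) - q ≤ 1 := sub_le_self _ q.2.1
  -- The weight `2 / p` makes the supersolution bound trivial at large labels: there `p * h a = 2`,
  -- while the sum is at most `1 + 2 / p * T ≤ 2`. At small labels the excess weight costs only `2 /
  -- p * T`.
  refine measure_merged_eq_zero hfin R hnull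
    (h := fun a => if a.ncard ≤ k then 1 else 2 / p) (fun a => ?_) fun w a => ?_
  · split_ifs
    exacts [le_rfl, hL]
  have hsum : ∑ b, (if ¬ Disjoint a b then (layersMeasure V M q).real (layersAt w ⁻¹' {b}) *
      (if b.ncard ≤ k then 1 else 2 / (p : ℝ)) else 0) ≤
      1 - (1 - q : ℝ) ^ a.ncard + 2 / p * T := by
    refine le_trans ?_ (add_le_add_right (mul_le_mul_of_nonneg_left (hT w) (by linarith)) _)
    rw [← layersMeasure_real_not_disjoint M q w a,
      measureReal_label_mem (measurable_layersAt w) fun b => ¬ Disjoint a b,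
      measureReal_label_mem (measurable_layersAt w) fun b => k < b.ncard, Finset.mul_sum,
      ← Finset.sum_add_distrib]
    refine Finset.sum_le_sum fun b _ => ?_
    have h0 : 0 ≤ (layersMeasure V M q).real (layersAt w ⁻¹' {b}) := measureReal_nonneg
    have h1 : 0 ≤ 2 / (p : ℝ) * (layersMeasure V M q).real (layersAt w ⁻¹' {b}) :=
      mul_nonneg (by linarith) h0
    by_cases hd : Disjoint a b <;> by_cases hb : b.ncard ≤ k
    · simp [hd, not_lt.2 hb]
    · simpa [hd, not_le.1 hb] using h1
    · simp [hd, hb, not_lt.2 hb]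
    · simp only [hd, hb, not_le.1 hb, not_false_eq_true, if_true, if_false]
      linarith
  refine hsum.trans ?_
  split_ifs with ha
  · have : (1 - q : ℝ) ^ k ≤ (1 - q : ℝ) ^ a.ncard := pow_le_pow_of_le_one hq0 hq1 ha
    linarith
  · have : 0 ≤ (1 - q : ℝ) ^ a.ncard := pow_nonneg hq0 _
    rw [mul_div_cancel₀ _ hp.ne']
    linarith

/-- A criterion for the absence of infinite clusters in bond percolation: labels of size less
than `k` are rare, and the other labels transmit with probability more than `p`. -/
lemma measure_bond_eq_zero_of_tail (R : Rooting G) (hfin : ∀ v, (G.neighborSet v).Finite)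
    {M k : ℕ} {p q : I} (hp : 0 < (p : ℝ))
    (hnull : layersMeasure V M q {ω | HasInfiniteCluster (mergedGraph G ω)} = 0)
    (hk : ∀ w : V, p ≤ 1 - (1 - q : ℝ) ^ k -
      (layersMeasure V M q).real {ω | (layersAt w ω).ncard < k}) :
    bondMeasure G p {B | HasInfiniteCluster (bondGraph G B)} = 0 := by
  have hq0 : (0 : ℝ) ≤ 1 - q := sub_nonneg.2 q.2.2
  have hq1 : (1 : ℝ) - q ≤ 1 := sub_le_self _ q.2.1
  -- Insisting that the child's label also be large loses at most the probability of small labels.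
  have hgood : ∀ (w : V) (a : Set (Fin M)), k ≤ a.ncard → (p : ℝ) ≤ (layersMeasure V M q).real
      {ω | ¬ Disjoint a (layersAt w ω) ∧ k ≤ (layersAt w ω).ncard} := by
    intro w a ha
    have h1 : (1 - q : ℝ) ^ a.ncard ≤ (1 - q : ℝ) ^ k := pow_le_pow_of_le_one hq0 hq1 ha
    have h2 := layersMeasure_real_not_disjoint M q w a
    have h3 : (layersMeasure V M q).real {ω | ¬ Disjoint a (layersAt w ω)} ≤
        (layersMeasure V M q).real {ω | ¬ Disjoint a (layersAt w ω) ∧ k ≤ (layersAt w ω).ncard} +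
        (layersMeasure V M q).real {ω | (layersAt w ω).ncard < k} := by
      refine (measureReal_mono ?_).trans (measureReal_union_le _ _)
      intro ω hω
      rcases lt_or_ge (layersAt w ω).ncard k with h | h
      exacts [Or.inr h, Or.inl ⟨hω, h⟩]
    linarith [hk w]
  refine measure_bond_eq_zero hfin R hnull (good := fun a => k ≤ a.ncard) (fun v => ?_) hgood
  have h1 : (layersMeasure V M q).real {ω | k ≤ (layersAt v ω).ncard} =
      1 - (layersMeasure V M q).real {ω | (layersAt v ω).ncard < k} := by
    rw [← probReal_compl_eq_one_sub (s := {ω | (layersAt v ω).ncard < k})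
      (measurable_layersAt v (Set.toFinite {b : Set (Fin M) | b.ncard < k}).measurableSet)]
    congr 1
    ext ω
    simp
  rw [h1]
  linarith [hk v, pow_nonneg hq0 k]

lemma tendsto_sqrt_natCast : Tendsto (fun M : ℕ => √(M : ℝ)) atTop atTop :=
  Real.tendsto_sqrt_atTop.comp tendsto_natCast_atTop_atTop

lemma tendsto_div_sqrt_natCast (a : ℝ) : Tendsto (fun M : ℕ => a / √(M : ℝ)) atTop (𝓝 0) :=
  tendsto_const_nhds.div_atTop tendsto_sqrt_natCast

/-- Follows from `log (1 - q) ≥ 1 - 1 / (1 - q) = -q / (1 - q)`. The correction `1 / (1 - q)`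
disappears as `q → 0`. -/
lemma exp_le_one_sub_pow {q x : ℝ} {k : ℕ} (hq1 : q < 1) (hk : k * q ≤ x) :
    Real.exp (-(x / (1 - q))) ≤ (1 - q) ^ k := by
  have hpos : 0 < 1 - q := sub_pos.2 hq1
  rw [← Real.exp_log (pow_pos hpos k), Real.log_pow]
  refine Real.exp_le_exp.2 ?_
  have h1 := Real.one_sub_inv_le_log_of_pos hpos
  have h2 : -(q / (1 - q)) ≤ Real.log (1 - q) := by
    refine le_trans (le_of_eq ?_) h1
    field_simp
    ring
  calc -(x / (1 - q)) ≤ -(k * q / (1 - q)) := by gcongr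
    _ = k * -(q / (1 - q)) := by ring
    _ ≤ k * Real.log (1 - q) := by gcongr

/-- At `q = a / √M` labels concentrate at size `a√M`, so sizes above `b√M` are rare. Smaller labels
transmit with probability at most about `1 - exp (-(a * b))`, below some `p` without infinite bond
clusters. -/
lemma eventually_le_multilayerThreshold (R : Rooting G) (hfin : ∀ v, (G.neighborSet v).Finite)
    {a b : ℝ} (ha : 0 < a) (hab : a < b) (h : 1 - Real.exp (-(a * b)) < bondThreshold G) :
    ∀ᶠ M : ℕ in atTop, a / √M ≤ multilayerThreshold G M := by
  have hexp : Real.exp (-(a * b)) ≤ 1 := Real.exp_le_one_iff.2 (by nlinarith)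
  obtain ⟨p, hxp, hnull⟩ := exists_null_of_lt_bondThreshold (by linarith) h
  have hp : 0 < (p : ℝ) := by linarith
  have hba : 0 < b - a := sub_pos.2 hab
  -- Chebyshev's bound at distance `(b - a)√M` from the mean `a√M` is `a / (b - a) ^ 2 / √M`.
  have hT : Tendsto (fun M : ℕ => 2 / (p : ℝ) * (a / (b - a) ^ 2 / √M)) atTop (𝓝 0) := by
    simpa using (tendsto_div_sqrt_natCast (a / (b - a) ^ 2)).const_mul (2 / (p : ℝ))
  have hlim : Tendsto (fun M : ℕ => 1 - Real.exp (-(a * b / (1 - a / √M))) +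
      2 / (p : ℝ) * (a / (b - a) ^ 2 / √M)) atTop (𝓝 (1 - Real.exp (-(a * b)))) := by
    have h1 : Tendsto (fun M : ℕ => a * b / (1 - a / √M)) atTop (𝓝 (a * b)) := by
      have := (tendsto_const_nhds (x := a * b)).div
        ((tendsto_div_sqrt_natCast a).const_sub 1) (by simp)
      rwa [sub_zero, div_one] at this
    simpa using (((Real.continuous_exp.tendsto _).comp h1.neg).const_sub 1).add hT
  filter_upwards [hlim.eventually_le_const hxp, hT.eventually_le_const one_pos,
    (tendsto_div_sqrt_natCast a).eventually_lt_const one_pos, eventually_gt_atTop 0]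
    with M hM hM1 hq1 hM0
  have hs : 0 < √(M : ℝ) := Real.sqrt_pos.2 (by exact_mod_cast hM0)
  have hss : √(M : ℝ) * √(M : ℝ) = M := Real.mul_self_sqrt (Nat.cast_nonneg M)
  let q : I := ⟨a / √M, by positivity, hq1.le⟩
  have hMq : (M : ℝ) * q = a * √M := by
    change (M : ℝ) * (a / √M) = _
    rw [mul_div_assoc', div_eq_iff hs.ne', mul_assoc, hss, mul_comm]
  refine le_multilayerThreshold (q := q) (measure_merged_eq_zero_of_tail R hfin (k := ⌊b * √M⌋₊) hp
    hnull (T := a / (b - a) ^ 2 / √M) (fun w => ?_) hM1 (le_trans ?_ hM))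
  · calc _ ≤ (layersMeasure V M q).real
          {ω | (b - a) * √M ≤ |((layersAt w ω).ncard : ℝ) - M * q|} := by
          refine measureReal_mono fun ω hω => ?_
          have : b * √M < (layersAt w ω).ncard := Nat.lt_of_floor_lt hω
          refine le_trans (b := ((layersAt w ω).ncard : ℝ) - M * q) ?_ (le_abs_self _)
          rw [hMq]
          linarith
      _ ≤ M * q / ((b - a) * √M) ^ 2 := layersMeasure_real_deviation M q w (by positivity)
      _ = _ := by
          rw [hMq]
          field_simp
  · gcongr
    refine exp_le_one_sub_pow hq1 ?_
    calc (⌊b * √M⌋₊ : ℝ) * (a / √M) ≤ b * √M * (a / √M) := by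
          gcongr
          exact Nat.floor_le (mul_nonneg (ha.trans hab).le hs.le)
      _ = a * b := by field_simp

/-- For `q > b / √M` the mean label size exceeds `b√M`, so sizes below `a√M` are rare and the others
transmit with probability at least `1 - exp (-(a * b))`. The estimates are uniform in such `q`, so
no monotonicity in `q` is needed. -/
lemma eventually_multilayerThreshold_le (R : Rooting G) (hfin : ∀ v, (G.neighborSet v).Finite)
    {a b : ℝ} (ha : 0 < a) (hab : a < b) (h : bondThreshold G < 1 - Real.exp (-(a * b))) :
    ∀ᶠ M : ℕ in atTop, multilayerThreshold G M ≤ b / √M := by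
  obtain ⟨x, hx, hxe⟩ := exists_between h
  have hx0 : 0 < x := bondThreshold_nonneg.trans_lt hx
  let p : I := ⟨x, hx0.le, by linarith [Real.exp_pos (-(a * b))]⟩
  have hb : 0 < b := ha.trans hab
  have hη : 0 < 1 - a / b := sub_pos.2 ((div_lt_one hb).2 hab)
  have hlim : Tendsto (fun M : ℕ => 1 - Real.exp (-(a * b)) - 1 / ((1 - a / b) ^ 2 * b) / √M) atTop
      (𝓝 (1 - Real.exp (-(a * b)))) := by
    have := (tendsto_div_sqrt_natCast (1 / ((1 - a / b) ^ 2 * b))).const_sub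
      (1 - Real.exp (-(a * b)))
    rwa [sub_zero] at this
  filter_upwards [hlim.eventually_const_le hxe, eventually_gt_atTop 0] with M hM hM0
  have hs : 0 < √(M : ℝ) := Real.sqrt_pos.2 (by exact_mod_cast hM0)
  have hss : √(M : ℝ) * √(M : ℝ) = M := Real.mul_self_sqrt (Nat.cast_nonneg M)
  refine Real.sSup_le ?_ (by positivity)
  rintro _ ⟨q, rfl, hq⟩
  by_contra! hlt
  have hqs : b < q * √M := (div_lt_iff₀ hs).1 hlt
  have hMq : b * √M ≤ M * q := by
    calc b * √M ≤ q * √M * √M := by gcongr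
      _ = M * q := by rw [mul_assoc, hss, mul_comm]
  have hMq0 : 0 < (M : ℝ) * q := lt_of_lt_of_le (by positivity) hMq
  -- Absence of infinite clusters at `q` would pass to bond percolation at `x > bondThreshold G`.
  refine hx.not_ge (le_bondThreshold (p := p)
    (measure_bond_eq_zero_of_tail R hfin (k := ⌈a * √M⌉₊) hx0 hq fun w => hM.trans ?_))
  refine sub_le_sub (sub_le_sub_left ?_ 1) ?_
  · calc (1 - q : ℝ) ^ ⌈a * √M⌉₊ ≤ Real.exp (-q) ^ ⌈a * √M⌉₊ := by
          gcongr
          · exact sub_nonneg.2 q.2.2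
          · exact Real.one_sub_le_exp_neg _
      _ = Real.exp (-(⌈a * √M⌉₊ * q)) := by rw [← Real.exp_nat_mul]; ring_nf
      _ ≤ Real.exp (-(a * b)) := by
          refine Real.exp_le_exp.2 (neg_le_neg ?_)
          calc a * b ≤ a * √M * q := by nlinarith
            _ ≤ _ := mul_le_mul_of_nonneg_right (Nat.le_ceil _) q.2.1
  · calc _ ≤ (layersMeasure V M q).real
          {ω | (1 - a / b) * (M * q) ≤ |((layersAt w ω).ncard : ℝ) - M * q|} := by
          refine measureReal_mono fun ω hω => ?_
          have h1 : ((layersAt w ω).ncard : ℝ) < a * √M := Nat.lt_ceil.1 hω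
          have h2 : a * √M = a / b * (b * √M) := by field_simp
          have h3 : a / b * (b * √M) ≤ a / b * (M * q) := by gcongr
          refine le_trans (b := -(((layersAt w ω).ncard : ℝ) - M * q)) ?_ (neg_le_abs _)
          linarith
      _ ≤ M * q / ((1 - a / b) * (M * q)) ^ 2 :=
          layersMeasure_real_deviation M q w (mul_pos hη hMq0)
      _ = 1 / ((1 - a / b) ^ 2) / (M * q) := by
          have := hη.ne'
          have := hMq0.ne'
          generalize 1 - a / b = η at *
          generalize (M : ℝ) * q = y at *
          field_simp
      _ ≤ 1 / ((1 - a / b) ^ 2) / (b * √M) := by gcongr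
      _ = _ := by
          generalize 1 - a / b = η at *
          field_simp

/-- The multilayer threshold of a tree is asymptotic to `√(-log (1 - p_c)) / √M`. -/
theorem multilayerThreshold_isEquivalent (hG : G.IsTree) (hc : bondThreshold G < 1) :
    (fun M : ℕ => multilayerThreshold G M) ~[atTop]
      fun M : ℕ => √(-Real.log (1 - bondThreshold G)) / √M := by
  obtain ⟨R⟩ := exists_rooting hG
  -- When `p_c = 0` the comparison function is identically zero, and equivalence to it amounts to
  -- eventual vanishing.
  have hzero : bondThreshold G = 0 → (∀ᶠ M in atTop, multilayerThreshold G M = 0) →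
      (fun M : ℕ => multilayerThreshold G M) ~[atTop]
        fun M : ℕ => √(-Real.log (1 - bondThreshold G)) / √M := by
    intro h0 h
    refine IsEquivalent.refl.congr_left ?_
    filter_upwards [h] with M hM
    simp [hM, h0]
  by_cases hfin : ∀ v, (G.neighborSet v).Finite
  swap
  · push Not at hfin
    obtain ⟨v, hv⟩ := hfin
    refine hzero (bondThreshold_eq_zero_of_infinite hv) ?_
    filter_upwards [eventually_gt_atTop 0] with M hM
    exact multilayerThreshold_eq_zero_of_infinite hv hM
  rcases bondThreshold_nonneg.eq_or_lt with h0 | h0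
  · refine hzero h0.symm ?_
    filter_upwards [eventually_gt_atTop 0] with M hM
    exact le_antisymm (h0 ▸ multilayerThreshold_le_bondThreshold R hfin hM)
      (multilayerThreshold_nonneg M)
  have hlog : 0 < -Real.log (1 - bondThreshold G) :=
    neg_pos.2 (Real.log_neg (by linarith) (by linarith))
  set c := √(-Real.log (1 - bondThreshold G)) with hcdef
  have hcpos : 0 < c := Real.sqrt_pos.2 hlog
  have hcc : Real.exp (-(c * c)) = 1 - bondThreshold G := by
    rw [hcdef, Real.mul_self_sqrt hlog.le, neg_neg, Real.exp_log (by linarith)]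
  rw [isEquivalent_iff_tendsto_one]
  swap
  · filter_upwards [eventually_gt_atTop 0] with M hM
    have : 0 < √(M : ℝ) := Real.sqrt_pos.2 (by exact_mod_cast hM)
    positivity
  have hexp : ∀ {x y : ℝ}, x < y → Real.exp (-y) < Real.exp (-x) := fun h =>
    Real.exp_lt_exp.2 (neg_lt_neg h)
  refine tendsto_order.2 ⟨fun x hx => ?_, fun x hx => ?_⟩
  -- Any ratio `y < 1` is reached with `a = y * c`, `b = c`, since `y * c * c < c * c` puts `1 - exp
  -- (-(a * b))` strictly below `p_c`. The maximum with `0` keeps `a` positive.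
  · obtain ⟨y, hy, hy1⟩ := exists_between (max_lt hx one_pos)
    have hy0 : 0 < y := (le_max_right _ _).trans_lt hy
    have hyc : y * c < c := by nlinarith
    have := eventually_le_multilayerThreshold R hfin (a := y * c) (b := c) (by positivity) hyc (by
      have := hexp (mul_lt_mul_of_pos_right hyc hcpos)
      linarith)
    filter_upwards [this, eventually_gt_atTop 0] with M hM hM0
    have hs : 0 < √(M : ℝ) := Real.sqrt_pos.2 (by exact_mod_cast hM0)
    refine ((le_max_left _ _).trans_lt hy).trans_le ?_
    rw [Pi.div_apply, le_div_iff₀ (by positivity)]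
    linarith [mul_div_assoc y c √(M : ℝ)]
  · obtain ⟨y, hy1, hy⟩ := exists_between hx
    have hyc : c < y * c := by nlinarith
    have := eventually_multilayerThreshold_le R hfin (a := c) (b := y * c) hcpos hyc (by
      have := hexp (mul_lt_mul_of_pos_left hyc hcpos)
      linarith)
    filter_upwards [this, eventually_gt_atTop 0] with M hM hM0
    have hs : 0 < √(M : ℝ) := Real.sqrt_pos.2 (by exact_mod_cast hM0)
    refine lt_of_le_of_lt ?_ hy
    rw [Pi.div_apply, div_le_iff₀ (by positivity)]
    linarith [mul_div_assoc y c √(M : ℝ)]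

end Thresholds

/-! ### Joint laws of finitely many links -/

section FiniteDimensional

/-- The site configurations in which both endpoints of `e` are occupied. -/
def occupied (e : Sym2 V) : Set (Set V) := {S | ∀ v ∈ e, v ∈ S}

lemma mem_occupied_mk {u v : V} {S : Set V} : S ∈ occupied s(u, v) ↔ u ∈ S ∧ v ∈ S := by
  simp [occupied]

lemma measurableSet_occupied (e : Sym2 V) : MeasurableSet (occupied e) := by
  induction e with
  | _ u v =>
    have : occupied s(u, v) = {S | u ∈ S} ∩ {S | v ∈ S} := by
      ext S
      exact mem_occupied_mk
    rw [this]
    exact (measurableSet_mem u).inter (measurableSet_mem v)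

lemma setBernoulli_real_subset (q : I) (T : Finset V) :
    (setBernoulli (Set.univ : Set V) q).real {S | ∀ v ∈ T, v ∈ S} = (q : ℝ) ^ T.card := by
  have hset : {S : Set V | ∀ v ∈ T, v ∈ S} = ⋂ v ∈ T, {S | v ∈ S} := by
    ext S
    simp
  rw [hset, Measure.real, (iIndepFun_mem_setBernoulli (Set.univ : Set V) q).meas_biInter
    fun v _ => ⟨{True}, measurableSet_singleton _, by ext S; simp⟩, ENNReal.toReal_prod]
  exact (Finset.prod_congr rfl fun v _ => setBernoulli_real_mem q (Set.mem_univ v)).trans (by simp)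

lemma setBernoulli_real_occupied (q : I) {e : Sym2 V} (he : ¬ e.IsDiag) :
    (setBernoulli (Set.univ : Set V) q).real (occupied e) = (q : ℝ) ^ 2 := by
  classical
  induction e with
  | _ u v =>
    have huv : u ≠ v := by simpa using he
    rw [← Finset.card_pair huv, ← setBernoulli_real_subset]
    congr 1
    ext S
    simp [occupied]

/-- Two distinct edges have at least three endpoints between them. -/
lemma setBernoulli_real_occupied_inter_le (q : I) {e f : Sym2 V} (he : ¬ e.IsDiag) (hf : ¬ f.IsDiag)
    (hef : e ≠ f) :
    (setBernoulli (Set.univ : Set V) q).real (occupied e ∩ occupied f) ≤ (q : ℝ) ^ 3 := by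
  classical
  obtain ⟨w, hwf, hwe⟩ : ∃ w ∈ f, w ∉ e := by
    by_contra! hcon
    induction f with
    | _ x y =>
      refine hef ((Sym2.mem_and_mem_iff ?_).1 ⟨hcon x (Sym2.mem_mk_left x y),
        hcon y (Sym2.mem_mk_right x y)⟩)
      simpa using hf
  induction e with
  | _ u v =>
    have huv : u ≠ v := by simpa using he
    have hw : w ≠ u ∧ w ≠ v := by simpa using hwe
    have hcard : ({w, u, v} : Finset V).card = 3 := by
      rw [Finset.card_insert_of_notMem (by simpa using hw), Finset.card_pair huv]
    rw [← hcard, ← setBernoulli_real_subset]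
    refine measureReal_mono fun S hS => ?_
    have h := mem_occupied_mk.1 hS.1
    simpa [h] using hS.2 w hwf

lemma measureReal_biUnion_occupied_le (q : I) (E : Finset (Sym2 V)) (hE : ∀ e ∈ E, ¬ e.IsDiag) :
    (setBernoulli (Set.univ : Set V) q).real (⋃ e ∈ E, occupied e) ≤ E.card * (q : ℝ) ^ 2 := by
  refine (measureReal_biUnion_finset_le E _).trans ?_
  rw [Finset.sum_congr rfl fun e he => setBernoulli_real_occupied q (hE e he)]
  simp

/-- A Bonferroni bound. Each new edge overlaps the earlier ones with probability at most `E.card * q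
^ 3`; the crude square `E.card ^ 2` absorbs the sum of these errors. -/
lemma le_measureReal_biUnion_occupied (q : I) (E : Finset (Sym2 V)) (hE : ∀ e ∈ E, ¬ e.IsDiag) :
    E.card * (q : ℝ) ^ 2 - (E.card : ℝ) ^ 2 * (q : ℝ) ^ 3 ≤
      (setBernoulli (Set.univ : Set V) q).real (⋃ e ∈ E, occupied e) := by
  classical
  induction E using Finset.induction_on with
  | empty => simp
  | insert e E he ih =>
    have ih := ih fun f hf => hE f (Finset.mem_insert_of_mem hf)
    have h1 := measureReal_union_add_inter (μ := setBernoulli (Set.univ : Set V) q)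
      (s := ⋃ f ∈ E, occupied f) (measurableSet_occupied e) (measure_ne_top _ _)
    have h2 : (setBernoulli (Set.univ : Set V) q).real ((⋃ f ∈ E, occupied f) ∩ occupied e) ≤
        E.card * (q : ℝ) ^ 3 := by
      rw [Set.iUnion₂_inter]
      refine (measureReal_biUnion_finset_le E _).trans ?_
      refine (Finset.sum_le_sum fun f hf => setBernoulli_real_occupied_inter_le q
        (hE f (Finset.mem_insert_of_mem hf)) (hE e (Finset.mem_insert_self e E)) ?_).trans (by simp)
      rintro rfl
      exact he hf
    rw [setBernoulli_real_occupied q (hE e (Finset.mem_insert_self e E))] at h1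
    rw [Finset.set_biUnion_insert, Set.union_comm, Finset.card_insert_of_notMem he]
    have h3 : 0 ≤ (q : ℝ) ^ 3 := pow_nonneg q.2.1 3
    have h4 : 0 ≤ (E.card : ℝ) * (q : ℝ) ^ 3 := by positivity
    push_cast
    nlinarith

variable {G : SimpleGraph V}

lemma mem_edgeSet_mergedGraph {M : ℕ} {e : Sym2 V} (he : e ∈ G.edgeSet) (ω : Fin M → Set V) :
    e ∈ (mergedGraph G ω).edgeSet ↔ ∃ m, ω m ∈ occupied e := by
  induction e with
  | _ u v =>
    rw [SimpleGraph.mem_edgeSet] at he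
    simp [mergedGraph, siteGraph, mem_occupied_mk, he]

lemma measurableSet_mem_edgeSet {M : ℕ} {e : Sym2 V} (he : e ∈ G.edgeSet) :
    MeasurableSet {ω : Fin M → Set V | e ∈ (mergedGraph G ω).edgeSet} := by
  have : {ω : Fin M → Set V | e ∈ (mergedGraph G ω).edgeSet} =
      ⋃ m, (fun ω : Fin M → Set V => ω m) ⁻¹' occupied e := by
    ext ω
    simp [mem_edgeSet_mergedGraph he]
  rw [this]
  exact MeasurableSet.iUnion fun m => measurable_pi_apply m (measurableSet_occupied e)

/-- Inactivity constrains each layer separately, so independence gives an `M`-th power. The form `1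
+ -x` suits the exponential limit. -/
lemma layersMeasure_real_inactive (M : ℕ) (q : I) (E : Finset (Sym2 V))
    (hE : (E : Set (Sym2 V)) ⊆ G.edgeSet) :
    (layersMeasure V M q).real {ω | ∀ e ∈ E, e ∉ (mergedGraph G ω).edgeSet} =
      (1 + -(setBernoulli (Set.univ : Set V) q).real (⋃ e ∈ E, occupied e)) ^ M := by
  have hset : {ω : Fin M → Set V | ∀ e ∈ E, e ∉ (mergedGraph G ω).edgeSet} =
      Set.univ.pi fun _ => (⋃ e ∈ E, occupied e)ᶜ := by
    ext ω
    simp only [Set.mem_ofPred_eq, Set.mem_univ_pi, Set.mem_compl_iff, Set.mem_iUnion, exists_prop,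
      not_exists, not_and]
    constructor
    · exact fun h m e he hm => h e he ((mem_edgeSet_mergedGraph (hE he) ω).2 ⟨m, hm⟩)
    · intro h e he hmem
      obtain ⟨m, hm⟩ := (mem_edgeSet_mergedGraph (hE he) ω).1 hmem
      exact h m e he hm
  rw [hset, layersMeasure, Measure.real, Measure.pi_pi, ENNReal.toReal_prod, ← sub_eq_add_neg,
    ← probReal_compl_eq_one_sub (Finset.measurableSet_biUnion E fun e _ => measurableSet_occupied e)]
  simp [Measure.real]

lemma tendsto_mul_sqrt {a : ℝ} {q : ℕ → I}
    (hq : (fun M : ℕ => (q M : ℝ)) ~[atTop] fun M : ℕ => a / √M) :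
    Tendsto (fun M : ℕ => (q M : ℝ) * √M) atTop (𝓝 a) := by
  have h := hq.mul (IsEquivalent.refl (u := fun M : ℕ => √(M : ℝ)) (l := atTop))
  refine h.symm.tendsto_nhds (tendsto_const_nhds.congr' ?_)
  filter_upwards [eventually_gt_atTop 0] with M hM
  have : √(M : ℝ) ≠ 0 := (Real.sqrt_pos.2 (by exact_mod_cast hM)).ne'
  simp [this]

/-- Since `M q ^ 2 → a ^ 2` and `M q ^ 3 → 0`, the Bonferroni bounds squeeze `M` times the one-layer
probability to `E.card * a ^ 2`. -/
lemma tendsto_inactive {a : ℝ} {q : ℕ → I}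
    (hq : (fun M : ℕ => (q M : ℝ)) ~[atTop] fun M : ℕ => a / √M) (E : Finset (Sym2 V))
    (hE : (E : Set (Sym2 V)) ⊆ G.edgeSet) :
    Tendsto (fun M : ℕ => (layersMeasure V M (q M)).real
      {ω | ∀ e ∈ E, e ∉ (mergedGraph G ω).edgeSet}) atTop (𝓝 (Real.exp (-a ^ 2) ^ E.card)) := by
  have hdiag : ∀ e ∈ E, ¬ e.IsDiag := fun e he => G.not_isDiag_of_mem_edgeSet (hE he)
  simp only [layersMeasure_real_inactive _ _ E hE]
  rw [← Real.exp_nat_mul]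
  refine Real.tendsto_one_add_pow_exp_of_tendsto ?_
  have hs := tendsto_mul_sqrt hq
  have hss : ∀ M : ℕ, √(M : ℝ) ^ 2 = M := fun M => Real.sq_sqrt (Nat.cast_nonneg M)
  have h2 : Tendsto (fun M : ℕ => (M : ℝ) * (q M : ℝ) ^ 2) atTop (𝓝 (a ^ 2)) := by
    refine (hs.pow 2).congr fun M => ?_
    rw [mul_pow, hss]
    ring
  have h0 : Tendsto (fun M : ℕ => (q M : ℝ)) atTop (𝓝 0) := hq.symm.tendsto_nhds (tendsto_div_sqrt_natCast a)
  have hup : Tendsto (fun M : ℕ => E.card * ((M : ℝ) * (q M : ℝ) ^ 2)) atTop (𝓝 (E.card * a ^ 2)) :=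
    h2.const_mul _
  have hlow : Tendsto (fun M : ℕ => E.card * ((M : ℝ) * (q M : ℝ) ^ 2) -
      (E.card : ℝ) ^ 2 * ((M : ℝ) * (q M : ℝ) ^ 2 * q M)) atTop (𝓝 (E.card * a ^ 2)) := by
    simpa using hup.sub ((h2.mul h0).const_mul ((E.card : ℝ) ^ 2))
  have := (tendsto_of_tendsto_of_tendsto_of_le_of_le
    (f := fun M : ℕ => (M : ℝ) * (setBernoulli (Set.univ : Set V) (q M)).real (⋃ e ∈ E, occupied e))
    hlow hup (fun M => ?_) fun M => ?_).neg
  · simpa using this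
  · refine le_trans (le_of_eq (by ring))
      (mul_le_mul_of_nonneg_left (le_measureReal_biUnion_occupied (q M) E hdiag) (Nat.cast_nonneg M))
  · refine (mul_le_mul_of_nonneg_left (measureReal_biUnion_occupied_le (q M) E hdiag)
      (Nat.cast_nonneg M)).trans (le_of_eq (by ring))

/-- Inclusion-exclusion one edge at a time: the probability with `e` active is the one with `e`
unconstrained minus the one with `e` inactive. The last moves `e` into `E`, hence the induction over
all `E`. -/
lemma tendsto_inactive_active {a : ℝ} {q : ℕ → I}
    (hq : (fun M : ℕ => (q M : ℝ)) ~[atTop] fun M : ℕ => a / √M) (E F : Finset (Sym2 V))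
    (hE : (E : Set (Sym2 V)) ⊆ G.edgeSet) (hF : (F : Set (Sym2 V)) ⊆ G.edgeSet)
    (hEF : Disjoint E F) :
    Tendsto (fun M : ℕ => (layersMeasure V M (q M)).real
      {ω | (∀ e ∈ E, e ∉ (mergedGraph G ω).edgeSet) ∧ ∀ e ∈ F, e ∈ (mergedGraph G ω).edgeSet}) atTop
      (𝓝 (Real.exp (-a ^ 2) ^ E.card * (1 - Real.exp (-a ^ 2)) ^ F.card)) := by
  classical
  induction F using Finset.induction_on generalizing E with
  | empty => simpa using tendsto_inactive hq E hE
  | insert e F he ih =>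
    rw [Finset.coe_insert, Set.insert_subset_iff] at hF
    rw [Finset.disjoint_insert_right] at hEF
    have h1 := ih E hE hF.2 hEF.2
    have h2 := ih (insert e E) (by simp [Set.insert_subset_iff, hF.1, hE]) hF.2
      (Finset.disjoint_insert_left.2 ⟨he, hEF.2⟩)
    rw [Finset.card_insert_of_notMem hEF.1] at h2
    rw [Finset.card_insert_of_notMem he]
    have hlim := h1.sub h2
    rw [show Real.exp (-a ^ 2) ^ E.card * (1 - Real.exp (-a ^ 2)) ^ F.card -
      Real.exp (-a ^ 2) ^ (E.card + 1) * (1 - Real.exp (-a ^ 2)) ^ F.card =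
      Real.exp (-a ^ 2) ^ E.card * (1 - Real.exp (-a ^ 2)) ^ (F.card + 1) by ring] at hlim
    refine hlim.congr fun M => ?_
    rw [sub_eq_iff_eq_add, ← measureReal_inter_add_sdiff (measurableSet_mem_edgeSet hF.1)]
    congr 2 <;> ext ω <;> simp only [Set.mem_inter_iff, Set.mem_sdiff, Set.mem_ofPred_eq,
      Finset.forall_mem_insert] <;> tauto

/-- The finite-dimensional distributions of the link states converge to those of i.i.d. Bernoulli
variables with parameter `1 - exp (-a ^ 2)`. -/
theorem tendsto_linkStateProb {a : ℝ} {q : ℕ → I}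
    (hq : (fun M : ℕ => (q M : ℝ)) ~[atTop] fun M : ℕ => a / √M) (F : Finset (Sym2 V))
    (hF : (F : Set (Sym2 V)) ⊆ G.edgeSet) (x : Sym2 V → Bool) :
    Tendsto (fun M : ℕ => linkStateProb G M (q M) F x) atTop
      (𝓝 (∏ e ∈ F, if x e = true then 1 - Real.exp (-a ^ 2) else Real.exp (-a ^ 2))) := by
  rw [Finset.prod_ite, Finset.prod_const, Finset.prod_const, mul_comm]
  have h := tendsto_inactive_active hq (F.filter fun e => ¬ x e = true)
    (F.filter fun e => x e = true) (fun e he => hF (Finset.mem_of_mem_filter e he))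
    (fun e he => hF (Finset.mem_of_mem_filter e he))
    (Finset.disjoint_filter_filter_not F F _).symm
  refine h.congr fun M => ?_
  rw [linkStateProb]
  congr 1
  ext ω
  simp only [Finset.mem_filter, Set.mem_ofPred_eq]
  constructor
  · rintro ⟨h0, h1⟩ e he
    by_cases hx : x e = true
    · exact iff_of_true (h1 e ⟨he, hx⟩) hx
    · exact iff_of_false (h0 e ⟨he, hx⟩) hx
  · exact fun h => ⟨fun e he hmem => he.2 ((h e he.1).1 hmem), fun e he => (h e he.1).2 he.2⟩

end FiniteDimensional

end MultilayerPercolation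

end

theorem theorem1 {V : Type*} [Countable V] (G : SimpleGraph V) (hG : G.IsTree) :
    -- the threshold
    (MultilayerPercolation.bondThreshold G < 1 →
      (fun M : ℕ => MultilayerPercolation.multilayerThreshold G M) ~[atTop]
        fun M : ℕ =>
          Real.sqrt (-Real.log (1 - MultilayerPercolation.bondThreshold G)) / Real.sqrt M) ∧
    -- the joint laws of finitely many links
    (∀ (a : ℝ) (_ : 0 ≤ a) (q : ℕ → unitInterval),
      ((fun M : ℕ => (q M : ℝ)) ~[atTop] fun M : ℕ => a / Real.sqrt M) →
      ∀ (F : Finset (Sym2 V)) (_ : (F : Set (Sym2 V)) ⊆ G.edgeSet) (x : Sym2 V → Bool),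
        Tendsto (fun M : ℕ => MultilayerPercolation.linkStateProb G M (q M) F x) atTop
          (𝓝 (∏ e ∈ F, if x e = true then 1 - Real.exp (-a ^ 2) else Real.exp (-a ^ 2)))) :=
  ⟨MultilayerPercolation.multilayerThreshold_isEquivalent hG,
    fun _ _ _ hq F hF x => MultilayerPercolation.tendsto_linkStateProb hq F hF x⟩
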